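/- A quantum coin flipping protocol with $N$ rounds is a two-party protocol on finite-dimensional quantum systems in which, in each of the $N$ rounds, Alice sends one message to Bob and then Bob sends one message to Alice; between messages each player may apply any quantum operation to its private memory and the message, and at the end Alice outputs $c_A$ and Bob outputs $c_B$, with $c_A,c_B\in\{0,1,\mathrm{Abort}\}$. The outcome is $c=c_A$ if $c_A=c_B$, and $c=\mathrm{Abort}$ otherwise. A cheating player may use an arbitrary quantum strategy with the same message systems, and also outputs a value at the end. A $WCF(1/2,\varepsilon)$ protocol is one such that $\Pr[c=0]=\Pr[c=1]=1/2$ if both players are honest, $\Pr[c=0]\le 1/2+\varepsilon$ whenever Bob is honest (whatever Alice does), and $\Pr[c=1]\le 1/2+\varepsilon$ whenever Alice is honest (whatever Bob does). A strong coin flipping protocol with cheating probability at most $\delta$ is one such that $\Pr[c=0]=\Pr[c=1]=1/2$ if both players are honest, and $\Pr[c=0]\le\delta$ and $\Pr[c=1]\le\delta$ whenever at least one of the players is honest and the other one cheats arbitrarily. **Theorem.** There is a function $r:\mathbb{R}\to\mathbb{R}$ with $r(\varepsilon)=o(\varepsilon)$ as $\varepsilon\to 0^+$ such that for all $\varepsilon>0$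 and $N\in\mathbb{N}$: if there exists a $WCF(1/2,\varepsilon)$ protocol with $N$ rounds, then there exists a strong coin flipping protocol with exactly $2\max\{0,\lceil\log_2(1/\varepsilon)\rceil\}\cdot N+2$ rounds and cheating probability at most $$\frac{1}{\sqrt2}+\sqrt2\,\varepsilon+r(\varepsilon).$$ (The maximum only matters for $\varepsilon>1$; for $\varepsilon\le 1$ the number of rounds is $2\lceil\log_2(1/\varepsilon)\rceil\cdot N+2$.) -/

import Mathlib

open scoped ComplexOrder Kronecker

namespace CoinFlip

/-- A density operator on the space with orthonormal basis `n`. -/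
structure DensityOp (n : Type) [Fintype n] [DecidableEq n] where
  mat : Matrix n n ℂ
  posSemidef : mat.PosSemidef
  trace_eq_one : mat.trace = 1

/-- A quantum operation (completely positive trace preserving map) on the space with
orthonormal basis `n`, given by finitely many Kraus operators. -/
structure Channel (n : Type) [Fintype n] [DecidableEq n] where
  index : Type
  [indexFintype : Fintype index]
  kraus : index → Matrix n n ℂ
  trace_preserving : ∑ i, (kraus i).conjTranspose * kraus i = 1

/-- A measurement (POVM) on the space with orthonormal basis `n` and outcomes in `X`. -/
structure Measurement (X : Type) [Fintype X] (n : Type) [Fintype n] [DecidableEq n] where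
  effect : X → Matrix n n ℂ
  posSemidef : ∀ x, (effect x).PosSemidef
  sum_eq_one : ∑ x, effect x = 1

/-- The values `0`, `1` and `Abort` (which is `none`). -/
abbrev Outcome : Type := Option (Fin 2)

/-- A strategy of Alice, honest or not, for communication through a message register `M`.
She starts with a state of her private memory and the message register, which she holds
before the first message. Her `k`-th message (`k = 0, 1, …`) is prepared by the operation
`step k` on memory and message register, the latter holding Bob's previous message if
there is one. At the end she measures her memory and Bob's last message. -/
structure AliceStrategy (M : Type) [Fintype M] [DecidableEq M] where
  mem : Type
  [memFintype : Fintype mem]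
  [memDecidableEq : DecidableEq mem]
  init : DensityOp (mem × M)
  step : ℕ → Channel (mem × M)
  output : Measurement Outcome (mem × M)

/-- A strategy of Bob, honest or not. He starts with a state of his private memory, answers
Alice's `k`-th message by the operation `step k` on message register and memory, and at the
end measures his memory. -/
structure BobStrategy (M : Type) [Fintype M] [DecidableEq M] where
  mem : Type
  [memFintype : Fintype mem]
  [memDecidableEq : DecidableEq mem]
  init : DensityOp mem
  step : ℕ → Channel (M × mem)
  output : Measurement Outcome mem

attribute [instance] Channel.indexFintype
attribute [instance] AliceStrategy.memFintype AliceStrategy.memDecidableEq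
attribute [instance] BobStrategy.memFintype BobStrategy.memDecidableEq

section Interaction

variable {A M B : Type} [Fintype A] [DecidableEq A] [Fintype M] [DecidableEq M]
  [Fintype B] [DecidableEq B]

/-- Alice's operation `Φ` acts on her memory `A` and the message `M`, and trivially on Bob's
memory `B`. -/
def aliceAct (Φ : Channel (A × M)) (ρ : Matrix ((A × M) × B) ((A × M) × B) ℂ) :
    Matrix ((A × M) × B) ((A × M) × B) ℂ :=
  ∑ i, (Φ.kraus i ⊗ₖ (1 : Matrix B B ℂ)) * ρ * (Φ.kraus i ⊗ₖ (1 : Matrix B B ℂ)).conjTranspose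

/-- The operator `1 ⊗ K` for an operator `K` on message and Bob's memory. -/
def onBob (K : Matrix (M × B) (M × B) ℂ) : Matrix ((A × M) × B) ((A × M) × B) ℂ :=
  Matrix.reindex (Equiv.prodAssoc A M B).symm (Equiv.prodAssoc A M B).symm
    ((1 : Matrix A A ℂ) ⊗ₖ K)

/-- Bob's operation `Φ` acts on the message `M` and his memory `B`, and trivially on Alice's
memory `A`. -/
def bobAct (Φ : Channel (M × B)) (ρ : Matrix ((A × M) × B) ((A × M) × B) ℂ) :
    Matrix ((A × M) × B) ((A × M) × B) ℂ :=
  ∑ i, onBob (Φ.kraus i) * ρ * (onBob (Φ.kraus i)).conjTranspose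

end Interaction

section Run

variable {M : Type} [Fintype M] [DecidableEq M]

/-- The joint state after `k` rounds; a round is one message from Alice to Bob followed by
one message from Bob to Alice. -/
noncomputable def state (a : AliceStrategy M) (b : BobStrategy M) :
    ℕ → Matrix ((a.mem × M) × b.mem) ((a.mem × M) × b.mem) ℂ
  | 0 => a.init.mat ⊗ₖ b.init.mat
  | k + 1 => bobAct (b.step k) (aliceAct (a.step k) (state a b k))

/-- The probability that after `N` rounds Alice outputs `x` and Bob outputs `y`. -/
noncomputable def jointProb (N : ℕ) (a : AliceStrategy M) (b : BobStrategy M)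
    (x y : Outcome) : ℝ :=
  ((a.output.effect x ⊗ₖ b.output.effect y) * state a b N).trace.re

/-- The outcome `c` of a coin flip from the two outputs `c_A` and `c_B`. -/
def combine (x y : Outcome) : Outcome := if x = y then x else none

/-- The probability that the outcome `c` of an `N`-round interaction is `v`. -/
noncomputable def outcomeProb (N : ℕ) (a : AliceStrategy M) (b : BobStrategy M)
    (v : Outcome) : ℝ :=
  ∑ x : Outcome, ∑ y : Outcome, if combine x y = v then jointProb N a b x y else 0

end Run

/-- A quantum coin flipping protocol: a number of rounds, a message register, and the honest
strategies of the two players (of which only the operations of the first `rounds` rounds are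
used). -/
structure Protocol where
  rounds : ℕ
  Msg : Type
  [msgFintype : Fintype Msg]
  [msgDecidableEq : DecidableEq Msg]
  alice : AliceStrategy Msg
  bob : BobStrategy Msg

attribute [instance] Protocol.msgFintype Protocol.msgDecidableEq

/-- The probability of outcome `v` when Alice uses `a` and Bob uses `b`. -/
noncomputable def Protocol.prob (P : Protocol) (a : AliceStrategy P.Msg)
    (b : BobStrategy P.Msg) (v : Outcome) : ℝ :=
  outcomeProb P.rounds a b v

/-- `P` is a weak coin flipping protocol `WCF(z, ε)`: Alice wins if the outcome is `0`, Bob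
wins if it is `1`. -/
structure IsWCF (P : Protocol) (z ε : ℝ) : Prop where
  honest_alice_wins : P.prob P.alice P.bob (some 0) = z
  honest_bob_wins : P.prob P.alice P.bob (some 1) = 1 - z
  alice_cheats : ∀ a : AliceStrategy P.Msg, P.prob a P.bob (some 0) ≤ z + ε
  bob_cheats : ∀ b : BobStrategy P.Msg, P.prob P.alice b (some 1) ≤ (1 - z) + ε

/-- `P` is a strong coin flipping protocol with cheating probability at most `δ`
(that is, with bias `δ - 1/2`). -/
structure IsSCF (P : Protocol) (δ : ℝ) : Prop where
  honest : ∀ v : Fin 2, P.prob P.alice P.bob (some v) = 1 / 2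
  alice_cheats : ∀ a : AliceStrategy P.Msg, ∀ v : Fin 2, P.prob a P.bob (some v) ≤ δ
  bob_cheats : ∀ b : BobStrategy P.Msg, ∀ v : Fin 2, P.prob P.alice b (some v) ≤ δ

end CoinFlip

set_option linter.unusedSectionVars false

/-! The strong flip uses a weak flip with a bias. Alice sends a uniform bit `c`; a weak coin that
Alice wins with probability `z` is flipped; Bob sends a bit `d` that is `true` with probability `s`.
The outcome is `c` if Alice won and `c + d` otherwise. It is uniform for honest players because `c`
is.

Apart from the error of the weak flip, a cheating Alice who wants `v` has two choices. If she sends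
`c = v`, the outcome is `v` unless she loses and Bob changes it: `1 - s * (1 - z)`. If she sends the
other bit, she must lose and Bob must change it: at most `s`. A cheating Bob is content with half of
the values of `c` and has to win the weak flip for the other half: `(1 + (1 - z)) / 2`. The three
numbers agree for `s = 1 / √2` and `z = 2 - √2`, where all equal `1 / √2`.

The bias comes from balanced flips, one per binary digit of the target
(`IsBalanced.exists_isBiased`). Playing a biased flip and then a balanced one, and letting Alice win
if she wins either or if she wins both, sends `z` to `(1 + z) / 2` or `z / 2`. The cheating gain is
halved, up to a new error of at most `ε`, so a gain of at most `2 * ε` persists. With `2 * ⌈log₂ (1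
/ ε)⌉` digits the target is missed by at most `ε ^ 2`, which is the term `r ε`.

The quantum content is sequential composition. A cheater may entangle the games, so bounds are
stated for expected rewards, for all memories and all unnormalized initial operators. Once a game is
over, the honest player's register is idle and may be measured before the next game; the next game
is then played from a conditional operator, and rewards are bounded by backward induction
(`AliceBound.seq`, `BobBound.seq`). For honest players the games are independent (`joint_seq`). -/

namespace CoinFlip

open Matrix

/-! ### Kraus maps, Kronecker products and relabelling of bases -/

section KrausMap

variable {n m u ι : Type} [Fintype n] [DecidableEq n] [Fintype m] [DecidableEq m]
  [Fintype u] [DecidableEq u] [Fintype ι]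

/-- The completely positive map with Kraus operators `K`. -/
def krausMap (K : ι → Matrix m n ℂ) (ρ : Matrix n n ℂ) : Matrix m m ℂ :=
  ∑ i, K i * ρ * (K i)ᴴ

theorem krausMap_reindex (e : n ≃ u) (K : ι → Matrix n n ℂ) (ρ : Matrix n n ℂ) :
    krausMap (fun i => reindex e e (K i)) (reindex e e ρ) = reindex e e (krausMap K ρ) := by
  simp only [krausMap, reindex_apply, conjTranspose_submatrix, submatrix_mul_equiv]
  ext x y
  simp [Matrix.sum_apply]

theorem krausMap_reindex' {T : Type} [Fintype T] [DecidableEq T] (e e' : n ≃ T)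
    (K : ι → Matrix n n ℂ) (ρ : Matrix n n ℂ) :
    krausMap (fun i => reindex e e' (K i)) (reindex e' e' ρ) = reindex e e (krausMap K ρ) := by
  simp only [krausMap, reindex_apply, conjTranspose_submatrix, submatrix_mul_equiv]
  ext x y
  simp [Matrix.sum_apply]

theorem krausMap_kronecker (K : ι → Matrix n n ℂ) (ρ : Matrix n n ℂ) (τ : Matrix u u ℂ) :
    krausMap (fun i => K i ⊗ₖ (1 : Matrix u u ℂ)) (ρ ⊗ₖ τ) = krausMap K ρ ⊗ₖ τ := by
  simp only [krausMap, conjTranspose_kronecker, ← mul_kronecker_mul, conjTranspose_one, one_mul,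
    mul_one]
  ext x y
  simp [Matrix.sum_apply, Finset.sum_mul]

theorem krausMap_conj (K : ι → Matrix n n ℂ) (D ρ : Matrix n n ℂ) (h : ∀ i, D * K i = K i * D) :
    krausMap K (D * ρ * Dᴴ) = D * krausMap K ρ * Dᴴ := by
  simp only [krausMap, Finset.mul_sum, Finset.sum_mul]
  refine Finset.sum_congr rfl fun i _ => ?_
  calc K i * (D * ρ * Dᴴ) * (K i)ᴴ = (K i * D) * ρ * (K i * D)ᴴ := by
        simp [conjTranspose_mul, Matrix.mul_assoc]
    _ = _ := by rw [← h]; simp [conjTranspose_mul, Matrix.mul_assoc]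

theorem krausMap_posSemidef (K : ι → Matrix m n ℂ) {ρ : Matrix n n ℂ} (h : ρ.PosSemidef) :
    (krausMap K ρ).PosSemidef :=
  posSemidef_sum _ fun i _ => h.mul_mul_conjTranspose_same (K i)

theorem trace_mul_krausMap (E : Matrix n n ℂ) (K : ι → Matrix n n ℂ) (ρ : Matrix n n ℂ)
    (hK : ∑ i, (K i)ᴴ * K i = 1) (h : ∀ i, E * K i = K i * E) :
    (E * krausMap K ρ).trace = (E * ρ).trace := by
  simp only [krausMap, Finset.mul_sum, trace_sum]
  calc ∑ i, (E * (K i * ρ * (K i)ᴴ)).trace = ∑ i, ((K i)ᴴ * K i * (E * ρ)).trace := by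
        refine Finset.sum_congr rfl fun i _ => ?_
        rw [← Matrix.mul_assoc, trace_mul_comm, ← Matrix.mul_assoc E, h]
        simp [Matrix.mul_assoc]
    _ = _ := by rw [← trace_sum, ← Finset.sum_mul, hK, one_mul]

theorem sum_kronecker {κ : Type} (t : Finset κ) (F : κ → Matrix n n ℂ) (τ : Matrix u u ℂ) :
    (∑ k ∈ t, F k) ⊗ₖ τ = ∑ k ∈ t, F k ⊗ₖ τ := by
  ext x y
  simp [Matrix.sum_apply, Finset.sum_mul]

theorem kronecker_sum {κ : Type} (t : Finset κ) (F : κ → Matrix n n ℂ) (τ : Matrix u u ℂ) :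
    τ ⊗ₖ (∑ k ∈ t, F k) = ∑ k ∈ t, τ ⊗ₖ F k := by
  ext x y
  simp [Matrix.sum_apply, Finset.mul_sum]

theorem reindex_sum {κ : Type} (e : n ≃ m) (t : Finset κ) (F : κ → Matrix n n ℂ) :
    reindex e e (∑ k ∈ t, F k) = ∑ k ∈ t, reindex e e (F k) := by
  ext x y
  simp [Matrix.sum_apply]

theorem reindex_one (e : n ≃ m) : reindex e e (1 : Matrix n n ℂ) = 1 := by
  simp

theorem trace_reindex (e : n ≃ m) (A : Matrix n n ℂ) : (reindex e e A).trace = A.trace := by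
  simpa [Matrix.trace] using e.symm.sum_comp fun i => A i i

theorem reindex_mul (e : n ≃ m) (A B : Matrix n n ℂ) :
    reindex e e (A * B) = reindex e e A * reindex e e B := by
  simp only [reindex_apply, submatrix_mul_equiv]

theorem conjTranspose_reindex' (e : n ≃ m) (A : Matrix n n ℂ) :
    (reindex e e A)ᴴ = reindex e e Aᴴ := by
  simp

theorem reindex_posSemidef (e : n ≃ m) {A : Matrix n n ℂ} (h : A.PosSemidef) :
    (reindex e e A).PosSemidef := by
  simpa using h.submatrix e.symm

theorem exists_conjTranspose_mul_self {A : Matrix n n ℂ} (h : A.PosSemidef) :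
    ∃ C : Matrix n n ℂ, A = Cᴴ * C := by
  open scoped MatrixOrder in
  obtain ⟨C, hC⟩ := CStarAlgebra.nonneg_iff_eq_star_mul_self.mp (Matrix.nonneg_iff_posSemidef.mpr h)
  exact ⟨C, hC⟩

theorem trace_conjTranspose_mul_mul (C ρ : Matrix n n ℂ) :
    (Cᴴ * C * ρ).trace = (C * ρ * Cᴴ).trace := by
  rw [trace_mul_comm (C * ρ), Matrix.mul_assoc]

theorem trace_mul_nonneg {E ρ : Matrix n n ℂ} (hE : E.PosSemidef) (hρ : ρ.PosSemidef) :
    0 ≤ (E * ρ).trace := by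
  obtain ⟨C, rfl⟩ := exists_conjTranspose_mul_self hE
  rw [trace_conjTranspose_mul_mul]
  exact (hρ.mul_mul_conjTranspose_same C).trace_nonneg

end KrausMap

/-! ### Interactions started from an arbitrary joint operator -/

section Evolution

variable {A M B A' M' B' u : Type} [Fintype A] [DecidableEq A] [Fintype M] [DecidableEq M]
  [Fintype B] [DecidableEq B] [Fintype A'] [DecidableEq A'] [Fintype M'] [DecidableEq M']
  [Fintype B'] [DecidableEq B'] [Fintype u] [DecidableEq u]

theorem aliceAct_eq (Φ : Channel (A × M)) (ρ : Matrix ((A × M) × B) ((A × M) × B) ℂ) :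
    aliceAct Φ ρ = krausMap (fun i => Φ.kraus i ⊗ₖ (1 : Matrix B B ℂ)) ρ := rfl

theorem bobAct_eq (Φ : Channel (M × B)) (ρ : Matrix ((A × M) × B) ((A × M) × B) ℂ) :
    bobAct Φ ρ = krausMap (fun i => onBob (Φ.kraus i)) ρ := rfl

/-- The joint state after a number of rounds, starting from an arbitrary joint operator. -/
def evo (α : ℕ → Channel (A × M)) (β : ℕ → Channel (M × B))
    (ρ : Matrix ((A × M) × B) ((A × M) × B) ℂ) : ℕ → Matrix ((A × M) × B) ((A × M) × B) ℂ
  | 0 => ρ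
  | k + 1 => bobAct (β k) (aliceAct (α k) (evo α β ρ k))

theorem state_eq_evo (a : AliceStrategy M) (b : BobStrategy M) (k : ℕ) :
    state a b k = evo a.step b.step (a.init.mat ⊗ₖ b.init.mat) k := by
  induction k with
  | zero => rfl
  | succ k ih => simp [state, evo, ih]

theorem evo_add (α : ℕ → Channel (A × M)) (β : ℕ → Channel (M × B))
    (ρ : Matrix ((A × M) × B) ((A × M) × B) ℂ) (n k : ℕ) :
    evo α β ρ (n + k) = evo (fun i => α (n + i)) (fun i => β (n + i)) (evo α β ρ n) k := by
  induction k with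
  | zero => rfl
  | succ k ih => rw [← add_assoc, evo, evo, ih]

/-- A map that intertwines the single steps intertwines the runs. This compares a run on a system
with idle or relabelled registers to a run on a smaller or differently arranged one. Only the steps
before `n` are constrained, since a composed game changes its steps when its first part ends. -/
theorem evo_map {α : ℕ → Channel (A × M)} {β : ℕ → Channel (M × B)}
    {α' : ℕ → Channel (A' × M')} {β' : ℕ → Channel (M' × B')}
    (Ψ : Matrix ((A × M) × B) ((A × M) × B) ℂ → Matrix ((A' × M') × B') ((A' × M') × B') ℂ)
    (n : ℕ)
    (hα : ∀ k < n, ∀ ρ, aliceAct (α' k) (Ψ ρ) = Ψ (aliceAct (α k) ρ))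
    (hβ : ∀ k < n, ∀ ρ, bobAct (β' k) (Ψ ρ) = Ψ (bobAct (β k) ρ))
    (ρ : Matrix ((A × M) × B) ((A × M) × B) ℂ) :
    evo α' β' (Ψ ρ) n = Ψ (evo α β ρ n) := by
  induction n with
  | zero => rfl
  | succ n ih =>
    rw [evo, ih (fun k hk => hα k (by omega)) (fun k hk => hβ k (by omega)),
      hα n (by omega), hβ n (by omega), evo]

/-- Here the coordinates change from `Ψ₀` to `Ψ` during Alice's first step: in a composition she
exchanges message registers there. This step must occur, hence `0 < n`. -/
theorem evo_map_first {α : ℕ → Channel (A × M)} {β : ℕ → Channel (M × B)}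
    {α' : ℕ → Channel (A' × M')} {β' : ℕ → Channel (M' × B')}
    (Ψ₀ Ψ : Matrix ((A × M) × B) ((A × M) × B) ℂ → Matrix ((A' × M') × B') ((A' × M') × B') ℂ)
    {n : ℕ} (hn : 0 < n)
    (h₀ : ∀ ρ, aliceAct (α' 0) (Ψ₀ ρ) = Ψ (aliceAct (α 0) ρ))
    (hα : ∀ k, 0 < k → ∀ ρ, aliceAct (α' k) (Ψ ρ) = Ψ (aliceAct (α k) ρ))
    (hβ : ∀ k ρ, bobAct (β' k) (Ψ ρ) = Ψ (bobAct (β k) ρ))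
    (ρ : Matrix ((A × M) × B) ((A × M) × B) ℂ) :
    evo α' β' (Ψ₀ ρ) n = Ψ (evo α β ρ n) := by
  induction n with
  | zero => omega
  | succ n ih =>
    rcases Nat.eq_zero_or_pos n with rfl | hpos
    · simp only [evo]
      rw [h₀, hβ]
    · rw [evo, ih hpos, hα n hpos, hβ, evo]

theorem onBob_mul (K L : Matrix (M × B) (M × B) ℂ) :
    (onBob (K * L) : Matrix ((A × M) × B) ((A × M) × B) ℂ) = onBob K * onBob L := by
  unfold onBob
  rw [← reindex_mul, ← mul_kronecker_mul, one_mul]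

theorem onBob_conjTranspose (K : Matrix (M × B) (M × B) ℂ) :
    (onBob K : Matrix ((A × M) × B) ((A × M) × B) ℂ)ᴴ = onBob Kᴴ := by
  unfold onBob
  rw [conjTranspose_reindex', conjTranspose_kronecker, conjTranspose_one]

theorem onBob_one : (onBob 1 : Matrix ((A × M) × B) ((A × M) × B) ℂ) = 1 := by
  simp [onBob]

theorem onBob_trace_preserving (Φ : Channel (M × B)) :
    ∑ i, (onBob (Φ.kraus i) : Matrix ((A × M) × B) ((A × M) × B) ℂ)ᴴ * onBob (Φ.kraus i) = 1 := by
  simp_rw [onBob_conjTranspose, ← onBob_mul]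
  rw [← onBob_one, ← Φ.trace_preserving]
  simp only [onBob, kronecker_sum, reindex_sum]

theorem kronecker_one_trace_preserving (Φ : Channel A) :
    ∑ i, (Φ.kraus i ⊗ₖ (1 : Matrix B B ℂ))ᴴ * (Φ.kraus i ⊗ₖ (1 : Matrix B B ℂ)) = 1 := by
  simp_rw [conjTranspose_kronecker, ← mul_kronecker_mul]
  rw [← sum_kronecker, Φ.trace_preserving, conjTranspose_one, one_mul, one_kronecker_one]

theorem evo_posSemidef (α : ℕ → Channel (A × M)) (β : ℕ → Channel (M × B))
    {ρ : Matrix ((A × M) × B) ((A × M) × B) ℂ} (h : ρ.PosSemidef) (k : ℕ) :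
    (evo α β ρ k).PosSemidef := by
  induction k with
  | zero => exact h
  | succ k ih => exact krausMap_posSemidef _ (krausMap_posSemidef _ ih)

/-- An operator commuting with all the Kraus operators has a constant expectation value. -/
theorem trace_mul_evo (E : Matrix ((A × M) × B) ((A × M) × B) ℂ)
    (α : ℕ → Channel (A × M)) (β : ℕ → Channel (M × B))
    (hα : ∀ k i, E * ((α k).kraus i ⊗ₖ (1 : Matrix B B ℂ)) = ((α k).kraus i ⊗ₖ 1) * E)
    (hβ : ∀ k i, E * onBob ((β k).kraus i) = onBob ((β k).kraus i) * E)
    (ρ : Matrix ((A × M) × B) ((A × M) × B) ℂ) (k : ℕ) :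
    (E * evo α β ρ k).trace = (E * ρ).trace := by
  induction k with
  | zero => rfl
  | succ k ih =>
    rw [evo, bobAct_eq, trace_mul_krausMap _ _ _ (onBob_trace_preserving _) (hβ k), aliceAct_eq,
      trace_mul_krausMap _ _ _ (kronecker_one_trace_preserving _) (hα k), ih]

theorem trace_evo (α : ℕ → Channel (A × M)) (β : ℕ → Channel (M × B))
    (ρ : Matrix ((A × M) × B) ((A × M) × B) ℂ) (k : ℕ) : (evo α β ρ k).trace = ρ.trace := by
  simpa using trace_mul_evo 1 α β (by simp) (by simp) ρ k

end Evolution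

/-! ### Extensions, products and relabellings of channels, states and measurements -/

section Constructions

variable {s u n m X Y : Type} [Fintype s] [DecidableEq s] [Fintype u] [DecidableEq u]
  [Fintype n] [DecidableEq n] [Fintype m] [DecidableEq m] [Fintype X] [Fintype Y]

/-- A channel acting on a part of a larger system. The coordinates of the larger system are given
by `e'` before and by `e` after the action. -/
def Channel.extend (e e' : s × u ≃ n) (Φ : Channel s) : Channel n where
  index := Φ.index
  kraus i := reindex e e' (Φ.kraus i ⊗ₖ (1 : Matrix u u ℂ))
  trace_preserving := by
    have h := congrArg (reindex e' e') (kronecker_one_trace_preserving Φ (B := u))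
    rw [reindex_one, reindex_sum] at h
    simpa only [reindex_apply, conjTranspose_submatrix, submatrix_mul_equiv] using h

/-- The channel that does nothing. -/
def Channel.id (n : Type) [Fintype n] [DecidableEq n] : Channel n where
  index := Unit
  kraus _ := 1
  trace_preserving := by simp

def DensityOp.prod (ρ : DensityOp n) (σ : DensityOp m) : DensityOp (n × m) where
  mat := ρ.mat ⊗ₖ σ.mat
  posSemidef := ρ.posSemidef.kronecker σ.posSemidef
  trace_eq_one := by rw [trace_kronecker, ρ.trace_eq_one, σ.trace_eq_one, one_mul]

def DensityOp.reindex (e : n ≃ m) (ρ : DensityOp n) : DensityOp m where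
  mat := Matrix.reindex e e ρ.mat
  posSemidef := reindex_posSemidef e ρ.posSemidef
  trace_eq_one := by rw [trace_reindex, ρ.trace_eq_one]

def Measurement.prod (E : Measurement X n) (F : Measurement Y m) : Measurement (X × Y) (n × m) where
  effect z := E.effect z.1 ⊗ₖ F.effect z.2
  posSemidef z := (E.posSemidef z.1).kronecker (F.posSemidef z.2)
  sum_eq_one := by
    simp_rw [Fintype.sum_prod_type, ← kronecker_sum, ← sum_kronecker]
    rw [E.sum_eq_one, F.sum_eq_one, one_kronecker_one]

def Measurement.reindex (e : n ≃ m) (E : Measurement X n) : Measurement X m where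
  effect x := Matrix.reindex e e (E.effect x)
  posSemidef x := reindex_posSemidef e (E.posSemidef x)
  sum_eq_one := by
    rw [← reindex_sum, E.sum_eq_one, reindex_one]

/-- Classical processing of the outcome of a measurement. -/
def Measurement.map [DecidableEq Y] (φ : X → Y) (E : Measurement X n) : Measurement Y n where
  effect y := ∑ x with φ x = y, E.effect x
  posSemidef y := posSemidef_sum _ fun x _ => E.posSemidef x
  sum_eq_one := by rw [Finset.sum_fiberwise, E.sum_eq_one]

/-- Alice's registers while the first of two composed protocols runs; `A' × M'` is idle. -/
def memEquiv (A M A' M' : Type) : (A × M) × (A' × M') ≃ (A × (A' × M')) × M where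
  toFun x := ((x.1.1, x.2), x.1.2)
  invFun x := ((x.1.1, x.2), x.1.2)
  left_inv _ := rfl
  right_inv _ := rfl

/-- Alice's registers while the second of two composed protocols runs; `A × M` is idle. -/
def memEquiv' (A M A' M' : Type) : (A' × M') × (A × M) ≃ (A × (A' × M)) × M' where
  toFun x := ((x.2.1, (x.1.1, x.2.2)), x.1.2)
  invFun x := ((x.1.2.1, x.2), (x.1.1, x.1.2.2))
  left_inv _ := rfl
  right_inv _ := rfl

/-- Alice's registers just before she turns to the second of two composed protocols. -/
def memEquivSwap (A M A' M' : Type) : (A' × M') × (A × M) ≃ (A × (A' × M')) × M :=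
  (Equiv.prodComm _ _).trans (memEquiv A M A' M')

/-- Bob's registers while the second of two composed protocols runs; `B` is idle. -/
def bobEquiv (M B B' : Type) : (M × B') × B ≃ M × (B × B') where
  toFun x := (x.1.1, (x.2, x.1.2))
  invFun x := ((x.1, x.2.2), x.2.1)
  left_inv _ := rfl
  right_inv _ := rfl

end Constructions

/-! ### Games, bounds on expected rewards, and sequential composition -/

/-- A two-party protocol with message register `M` and outputs in `X`. -/
structure Game (M : Type) [Fintype M] [DecidableEq M] (X : Type) [Fintype X] where
  rounds : ℕ
  memA : Type
  [fintypeA : Fintype memA]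
  [decidableEqA : DecidableEq memA]
  memB : Type
  [fintypeB : Fintype memB]
  [decidableEqB : DecidableEq memB]
  initA : DensityOp (memA × M)
  initB : DensityOp memB
  stepA : ℕ → Channel (memA × M)
  stepB : ℕ → Channel (M × memB)
  outA : Measurement X (memA × M)
  outB : Measurement X memB

attribute [instance] Game.fintypeA Game.decidableEqA Game.fintypeB Game.decidableEqB

namespace Game

variable {M X Y : Type} [Fintype M] [DecidableEq M] [Fintype X] [Fintype Y]

/-- Whatever Alice does, the expectation of the reward `f` of honest Bob's output is at most `v`.
Alice's initial state need not be normalized. -/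
def AliceBound (G : Game M X) (f : X → ℝ) (v : ℝ) : Prop :=
  ∀ (A : Type) [Fintype A] [DecidableEq A] (ρ : Matrix (A × M) (A × M) ℂ), ρ.PosSemidef →
    ∀ α : ℕ → Channel (A × M),
      ∑ y, f y * (((1 : Matrix (A × M) (A × M) ℂ) ⊗ₖ G.outB.effect y) *
        evo α G.stepB (ρ ⊗ₖ G.initB.mat) G.rounds).trace.re ≤ v * ρ.trace.re

/-- Whatever Bob does, the expectation of the reward `f` of honest Alice's output is at most `v`. -/
def BobBound (G : Game M X) (f : X → ℝ) (v : ℝ) : Prop :=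
  ∀ (B : Type) [Fintype B] [DecidableEq B] (σ : Matrix B B ℂ), σ.PosSemidef →
    ∀ β : ℕ → Channel (M × B),
      ∑ x, f x * ((G.outA.effect x ⊗ₖ (1 : Matrix B B ℂ)) *
        evo G.stepA β (G.initA.mat ⊗ₖ σ) G.rounds).trace.re ≤ v * σ.trace.re

/-- The joint distribution of the outputs of the honest players. -/
def joint (G : Game M X) (x y : X) : ℂ :=
  ((G.outA.effect x ⊗ₖ G.outB.effect y) *
    evo G.stepA G.stepB (G.initA.mat ⊗ₖ G.initB.mat) G.rounds).trace

/-- Sequential composition. While the first protocol runs, Alice keeps the initial message of the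
second one in her memory; then she exchanges it with the message register. -/
abbrev seq (G : Game M X) (H : Game M Y) : Game M (X × Y) where
  rounds := G.rounds + H.rounds
  memA := G.memA × (H.memA × M)
  memB := G.memB × H.memB
  initA := (G.initA.prod H.initA).reindex (memEquiv G.memA M H.memA M)
  initB := G.initB.prod H.initB
  stepA k :=
    if k < G.rounds then (G.stepA k).extend (memEquiv G.memA M H.memA M) (memEquiv G.memA M H.memA M)
    else if k = G.rounds then
      (H.stepA 0).extend (memEquiv' G.memA M H.memA M) (memEquivSwap G.memA M H.memA M)
    else (H.stepA (k - G.rounds)).extend (memEquiv' G.memA M H.memA M) (memEquiv' G.memA M H.memA M)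
  stepB k :=
    if k < G.rounds then (G.stepB k).extend (Equiv.prodAssoc M G.memB H.memB) (Equiv.prodAssoc _ _ _)
    else (H.stepB (k - G.rounds)).extend (bobEquiv M G.memB H.memB) (bobEquiv M G.memB H.memB)
  -- These are the coordinates after the exchange of the message registers, so the measurement is
  -- the intended one only if `H` has at least one round.
  outA := ((G.outA.prod H.outA).reindex
    ((Equiv.prodComm _ _).trans (memEquiv' G.memA M H.memA M)))
  outB := G.outB.prod H.outB

/-- Classical processing of the outputs. -/
abbrev map [DecidableEq Y] (φ ψ : X → Y) (G : Game M X) : Game M Y where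
  rounds := G.rounds
  memA := G.memA
  memB := G.memB
  initA := G.initA
  initB := G.initB
  stepA := G.stepA
  stepB := G.stepB
  outA := G.outA.map φ
  outB := G.outB.map ψ

theorem AliceBound.map [DecidableEq Y] {G : Game M X} {φ ψ : X → Y} {f : Y → ℝ} {v : ℝ}
    (h : G.AliceBound (fun x => f (ψ x)) v) : (G.map φ ψ).AliceBound f v := by
  intro A _ _ ρ hρ α
  refine le_trans (le_of_eq ?_) (h A ρ hρ α)
  rw [← Finset.sum_fiberwise (g := ψ)]
  refine Finset.sum_congr rfl fun y _ => ?_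
  rw [Finset.sum_congr rfl (g := fun x => f y * (((1 : Matrix (A × M) (A × M) ℂ) ⊗ₖ
    G.outB.effect x) * evo α G.stepB (ρ ⊗ₖ G.initB.mat) G.rounds).trace.re)
    (fun x hx => by simp only [(Finset.mem_filter.mp hx).2])]
  rw [← Finset.mul_sum, ← Complex.re_sum, ← trace_sum, ← Finset.sum_mul]
  congr 5
  exact kronecker_sum _ _ _

theorem BobBound.map [DecidableEq Y] {G : Game M X} {φ ψ : X → Y} {f : Y → ℝ} {v : ℝ}
    (h : G.BobBound (fun x => f (φ x)) v) : (G.map φ ψ).BobBound f v := by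
  intro B _ _ σ hσ β
  refine le_trans (le_of_eq ?_) (h B σ hσ β)
  rw [← Finset.sum_fiberwise (g := φ)]
  refine Finset.sum_congr rfl fun y _ => ?_
  rw [Finset.sum_congr rfl (g := fun x => f y * ((G.outA.effect x ⊗ₖ (1 : Matrix B B ℂ)) *
    evo G.stepA β (G.initA.mat ⊗ₖ σ) G.rounds).trace.re)
    (fun x hx => by simp only [(Finset.mem_filter.mp hx).2])]
  rw [← Finset.mul_sum, ← Complex.re_sum, ← trace_sum, ← Finset.sum_mul]
  congr 5
  exact sum_kronecker _ _ _

theorem joint_map [DecidableEq Y] (G : Game M X) (φ ψ : X → Y) (x y : Y) :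
    (G.map φ ψ).joint x y = ∑ x' with φ x' = x, ∑ y' with ψ y' = y, G.joint x' y' := by
  simp only [joint, ← trace_sum, ← Finset.sum_mul]
  congr 2
  simp only [← kronecker_sum, ← sum_kronecker]
  rfl

theorem sum_outA_kronecker (G : Game M X) {B : Type} [Fintype B] [DecidableEq B] :
    ∑ x, G.outA.effect x ⊗ₖ (1 : Matrix B B ℂ) = 1 := by
  rw [← sum_kronecker, G.outA.sum_eq_one, one_kronecker_one]

theorem sum_kronecker_outB (G : Game M X) {A : Type} [Fintype A] [DecidableEq A] :
    ∑ x, (1 : Matrix A A ℂ) ⊗ₖ G.outB.effect x = 1 := by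
  rw [← kronecker_sum, G.outB.sum_eq_one, one_kronecker_one]

theorem aliceBound_const (G : Game M X) (v : ℝ) : G.AliceBound (fun _ => v) v := by
  intro A _ _ ρ hρ α
  rw [← Finset.mul_sum, ← Complex.re_sum, ← trace_sum, ← Finset.sum_mul, sum_kronecker_outB,
    one_mul, trace_evo, trace_kronecker, G.initB.trace_eq_one, mul_one]

theorem bobBound_const (G : Game M X) (v : ℝ) : G.BobBound (fun _ => v) v := by
  intro B _ _ σ hσ β
  rw [← Finset.mul_sum, ← Complex.re_sum, ← trace_sum, ← Finset.sum_mul, sum_outA_kronecker,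
    one_mul, trace_evo, trace_kronecker, G.initA.trace_eq_one, one_mul]

/-- States and effects are positive, so each output has nonnegative weight and a pointwise larger
reward has a larger expectation. -/
theorem AliceBound.mono {G : Game M X} {f g : X → ℝ} {v w : ℝ} (h : G.AliceBound g v)
    (hfg : ∀ x, f x ≤ g x) (hvw : v ≤ w) : G.AliceBound f w := by
  intro A _ _ ρ hρ α
  refine le_trans (Finset.sum_le_sum fun y _ => ?_) ((h A ρ hρ α).trans ?_)
  · refine mul_le_mul_of_nonneg_right (hfg y) (Complex.nonneg_iff.mp (trace_mul_nonneg ?_ ?_)).1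
    · exact PosSemidef.one.kronecker (G.outB.posSemidef y)
    · exact evo_posSemidef _ _ (hρ.kronecker G.initB.posSemidef) _
  · exact mul_le_mul_of_nonneg_right hvw (Complex.nonneg_iff.mp hρ.trace_nonneg).1

theorem BobBound.mono {G : Game M X} {f g : X → ℝ} {v w : ℝ} (h : G.BobBound g v)
    (hfg : ∀ x, f x ≤ g x) (hvw : v ≤ w) : G.BobBound f w := by
  intro B _ _ σ hσ β
  refine le_trans (Finset.sum_le_sum fun y _ => ?_) ((h B σ hσ β).trans ?_)
  · refine mul_le_mul_of_nonneg_right (hfg y) (Complex.nonneg_iff.mp (trace_mul_nonneg ?_ ?_)).1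
    · exact (G.outA.posSemidef y).kronecker PosSemidef.one
    · exact evo_posSemidef _ _ (G.initA.posSemidef.kronecker hσ) _
  · exact mul_le_mul_of_nonneg_right hvw (Complex.nonneg_iff.mp hσ.trace_nonneg).1

/-- Bounds are affine in the reward. -/
theorem AliceBound.affine {G : Game M X} {f : X → ℝ} {v : ℝ} (h : G.AliceBound f v) (c d : ℝ)
    (hc : 0 ≤ c) : G.AliceBound (fun x => c * f x + d) (c * v + d) := by
  intro A _ _ ρ hρ α
  have h1 := mul_le_mul_of_nonneg_left (h A ρ hρ α) hc
  have h2 := G.aliceBound_const d A ρ hρ α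
  rw [Finset.mul_sum] at h1
  simp only [add_mul, Finset.sum_add_distrib, mul_assoc] at h1 h2 ⊢
  exact add_le_add h1 h2

theorem BobBound.affine {G : Game M X} {f : X → ℝ} {v : ℝ} (h : G.BobBound f v) (c d : ℝ)
    (hc : 0 ≤ c) : G.BobBound (fun x => c * f x + d) (c * v + d) := by
  intro B _ _ σ hσ β
  have h1 := mul_le_mul_of_nonneg_left (h B σ hσ β) hc
  have h2 := G.bobBound_const d B σ hσ β
  rw [Finset.mul_sum] at h1
  simp only [add_mul, Finset.sum_add_distrib, mul_assoc] at h1 h2 ⊢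
  exact add_le_add h1 h2

end Game

/-! ### Measuring an idle register before the interaction -/

section Conditioning

variable {A M B : Type} [Fintype A] [DecidableEq A] [Fintype M] [DecidableEq M]
  [Fintype B] [DecidableEq B]

/-- An effect on the part of Alice's system on which nothing acts any more can be measured
before the interaction. -/
theorem trace_evo_condition_alice (D : Matrix A A ℂ) (F : Matrix B B ℂ)
    (α : ℕ → Channel (A × M)) (β : ℕ → Channel (M × B))
    (hα : ∀ k i, (D ⊗ₖ (1 : Matrix M M ℂ)) * (α k).kraus i = (α k).kraus i * (D ⊗ₖ 1))
    (ρ : Matrix (A × M) (A × M) ℂ) (σ : Matrix B B ℂ) (n : ℕ) :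
    ((((Dᴴ * D) ⊗ₖ (1 : Matrix M M ℂ)) ⊗ₖ F) * evo α β (ρ ⊗ₖ σ) n).trace =
      (((1 : Matrix (A × M) (A × M) ℂ) ⊗ₖ F) *
        evo α β (((D ⊗ₖ 1) * ρ * (D ⊗ₖ 1)ᴴ) ⊗ₖ σ) n).trace := by
  set D' : Matrix ((A × M) × B) ((A × M) × B) ℂ := (D ⊗ₖ (1 : Matrix M M ℂ)) ⊗ₖ 1 with hD'
  have h1 : ((Dᴴ * D) ⊗ₖ (1 : Matrix M M ℂ)) ⊗ₖ F = D'ᴴ * (1 ⊗ₖ F) * D' := by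
    simp [hD', conjTranspose_kronecker, ← mul_kronecker_mul]
  have h2 : ((D ⊗ₖ 1) * ρ * (D ⊗ₖ 1)ᴴ) ⊗ₖ σ = D' * (ρ ⊗ₖ σ) * D'ᴴ := by
    simp [hD', conjTranspose_kronecker, ← mul_kronecker_mul]
  -- `D'` commutes with the Kraus operators of both players, so it moves between the end of the run
  -- and its beginning.
  have h3 : evo α β (D' * (ρ ⊗ₖ σ) * D'ᴴ) n = D' * evo α β (ρ ⊗ₖ σ) n * D'ᴴ := by
    refine evo_map (fun ρ => D' * ρ * D'ᴴ) n ?_ ?_ _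
    · intro k _ τ
      refine krausMap_conj _ _ _ fun i => ?_
      simp [hD', ← mul_kronecker_mul, hα]
    · intro k _ τ
      refine krausMap_conj _ _ _ fun i => ?_
      have : D' = reindex (Equiv.prodAssoc A M B).symm (Equiv.prodAssoc A M B).symm
          (D ⊗ₖ (1 : Matrix (M × B) (M × B) ℂ)) := by
        ext ⟨⟨a, m⟩, b⟩ ⟨⟨a', m'⟩, b'⟩
        simp [hD', one_apply, ← ite_and, and_comm]
      rw [this, onBob, ← reindex_mul, ← reindex_mul, ← mul_kronecker_mul, ← mul_kronecker_mul]
      simp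
  rw [h1, h2, h3, Matrix.mul_assoc, Matrix.mul_assoc, trace_mul_comm]
  simp only [Matrix.mul_assoc]

theorem trace_evo_condition_bob (E : Matrix (A × M) (A × M) ℂ) (D : Matrix B B ℂ)
    (α : ℕ → Channel (A × M)) (β : ℕ → Channel (M × B))
    (hβ : ∀ k i, ((1 : Matrix M M ℂ) ⊗ₖ D) * (β k).kraus i = (β k).kraus i * (1 ⊗ₖ D))
    (ρ : Matrix (A × M) (A × M) ℂ) (σ : Matrix B B ℂ) (n : ℕ) :
    ((E ⊗ₖ (Dᴴ * D)) * evo α β (ρ ⊗ₖ σ) n).trace =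
      ((E ⊗ₖ (1 : Matrix B B ℂ)) * evo α β (ρ ⊗ₖ (D * σ * Dᴴ)) n).trace := by
  set D' : Matrix ((A × M) × B) ((A × M) × B) ℂ := (1 : Matrix (A × M) (A × M) ℂ) ⊗ₖ D with hD'
  have h1 : E ⊗ₖ (Dᴴ * D) = D'ᴴ * (E ⊗ₖ 1) * D' := by
    simp [hD', conjTranspose_kronecker, ← mul_kronecker_mul]
  have h2 : ρ ⊗ₖ (D * σ * Dᴴ) = D' * (ρ ⊗ₖ σ) * D'ᴴ := by
    simp [hD', conjTranspose_kronecker, ← mul_kronecker_mul]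
  have h3 : evo α β (D' * (ρ ⊗ₖ σ) * D'ᴴ) n = D' * evo α β (ρ ⊗ₖ σ) n * D'ᴴ := by
    refine evo_map (fun ρ => D' * ρ * D'ᴴ) n ?_ ?_ _
    · intro k _ τ
      refine krausMap_conj _ _ _ fun i => ?_
      simp [hD', ← mul_kronecker_mul]
    · intro k _ τ
      refine krausMap_conj _ _ _ fun i => ?_
      have : D' = onBob ((1 : Matrix M M ℂ) ⊗ₖ D) := by
        ext ⟨⟨a, m⟩, b⟩ ⟨⟨a', m'⟩, b'⟩
        simp [hD', onBob, one_apply, ← ite_and, and_comm]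
      rw [this, ← onBob_mul, ← onBob_mul, hβ]
  rw [h1, h2, h3, Matrix.mul_assoc, Matrix.mul_assoc, trace_mul_comm]
  simp only [Matrix.mul_assoc]

end Conditioning

/-! ### Registers of a composed game against those of its parts -/

section Embedding

variable {A₁ A₂ M B B₁ B₂ : Type} [Fintype A₁] [DecidableEq A₁] [Fintype A₂] [DecidableEq A₂]
  [Fintype M] [DecidableEq M] [Fintype B] [DecidableEq B] [Fintype B₁] [DecidableEq B₁]
  [Fintype B₂] [DecidableEq B₂]

/-- The registers of the first of two composed protocols. -/
def firstEquiv (A₁ A₂ M B : Type) : ((A₁ × M) × B) × (A₂ × M) ≃ ((A₁ × (A₂ × M)) × M) × B where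
  toFun x := (((x.1.1.1, x.2), x.1.1.2), x.1.2)
  invFun x := (((x.1.1.1, x.1.2), x.2), x.1.1.2)
  left_inv _ := rfl
  right_inv _ := rfl

/-- The registers of the second of two composed protocols. -/
def secondEquiv (A₁ A₂ M B : Type) :
    (A₂ × M) × ((A₁ × M) × B) ≃ ((A₁ × (A₂ × M)) × M) × B where
  toFun x := (((x.2.1.1, (x.1.1, x.2.1.2)), x.1.2), x.2.2)
  invFun x := ((x.1.1.2.1, x.1.2), ((x.1.1.1, x.1.1.2.2), x.2))
  left_inv _ := rfl
  right_inv _ := rfl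

/-- All registers between two composed protocols. -/
def secondEquivSwap (A₁ A₂ M B : Type) :
    (A₂ × M) × ((A₁ × M) × B) ≃ ((A₁ × (A₂ × M)) × M) × B :=
  (Equiv.prodComm _ _).trans (firstEquiv A₁ A₂ M B)

/-- Bob's view, with the idle registers `A₁ × M` of Alice counted as his memory. -/
def bobMemEquiv (A₁ M B : Type) : (M × B) × (A₁ × M) ≃ M × ((A₁ × M) × B) where
  toFun x := (x.1.1, (x.2, x.1.2))
  invFun x := ((x.1, x.2.2), x.2.1)
  left_inv _ := rfl
  right_inv _ := rfl

/-- The registers of the second protocol, with Bob's idle register `B₁` counted as part of the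
memory of a cheating Alice. -/
def cheatEquiv (A₁ M B₁ B₂ : Type) : ((A₁ × B₁) × M) × B₂ ≃ (A₁ × M) × (B₁ × B₂) where
  toFun x := ((x.1.1.1, x.1.2), (x.1.1.2, x.2))
  invFun x := (((x.1.1, x.2.1), x.1.2), x.2.2)
  left_inv _ := rfl
  right_inv _ := rfl

/-- Hands Bob's idle register `B₁` to a cheating Alice. -/
def cheatMemEquiv (A₁ M B₁ : Type) : (A₁ × M) × B₁ ≃ (A₁ × B₁) × M where
  toFun x := ((x.1.1, x.2), x.1.2)
  invFun x := ((x.1.1, x.2), x.1.2)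
  left_inv _ := rfl
  right_inv _ := rfl

/-- Splits the system into the registers of the second and of the first game, so that honest play
becomes a tensor product. -/
def honestEquiv (A₁ A₂ M B₁ B₂ : Type) :
    ((A₂ × M) × B₂) × ((A₁ × M) × B₁) ≃ (A₂ × M) × ((A₁ × M) × (B₁ × B₂)) where
  toFun x := (x.1.1, (x.2.1, (x.2.2, x.1.2)))
  invFun x := ((x.1, x.2.2.2), (x.2.1, x.2.2.1))
  left_inv _ := rfl
  right_inv _ := rfl

/-- This and the following lemmas are the intertwining relations that `evo_map` and `evo_map_first`
ask for. Each reduces to an equality of Kraus operators, checked entrywise. -/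
theorem aliceAct_firstEquiv (Φ : Channel (A₁ × M)) (X : Matrix ((A₁ × M) × B) ((A₁ × M) × B) ℂ)
    (τ : Matrix (A₂ × M) (A₂ × M) ℂ) :
    aliceAct (Φ.extend (memEquiv A₁ M A₂ M) (memEquiv A₁ M A₂ M))
      (reindex (firstEquiv A₁ A₂ M B) (firstEquiv A₁ A₂ M B) (X ⊗ₖ τ)) =
      reindex (firstEquiv A₁ A₂ M B) (firstEquiv A₁ A₂ M B) (aliceAct Φ X ⊗ₖ τ) := by
  rw [aliceAct_eq Φ, ← krausMap_kronecker, ← krausMap_reindex]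
  refine congrArg (fun K : Φ.index → _ => krausMap K _) (funext fun i => ?_)
  ext ⟨⟨⟨a, c, n⟩, m⟩, b⟩ ⟨⟨⟨a', c', n'⟩, m'⟩, b'⟩
  simp [Channel.extend, memEquiv, firstEquiv, one_apply, ← ite_and]
  grind

theorem bobAct_firstEquiv (Φ : Channel (M × B)) (X : Matrix ((A₁ × M) × B) ((A₁ × M) × B) ℂ)
    (τ : Matrix (A₂ × M) (A₂ × M) ℂ) :
    bobAct Φ (reindex (firstEquiv A₁ A₂ M B) (firstEquiv A₁ A₂ M B) (X ⊗ₖ τ)) =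
      reindex (firstEquiv A₁ A₂ M B) (firstEquiv A₁ A₂ M B) (bobAct Φ X ⊗ₖ τ) := by
  rw [bobAct_eq, bobAct_eq, ← krausMap_kronecker, ← krausMap_reindex]
  refine congrArg (fun K : Φ.index → _ => krausMap K _) (funext fun i => ?_)
  ext ⟨⟨⟨a, c, n⟩, m⟩, b⟩ ⟨⟨⟨a', c', n'⟩, m'⟩, b'⟩
  simp [onBob, firstEquiv, one_apply, ← ite_and]
  grind

theorem aliceAct_secondEquivSwap (Φ : Channel (A₂ × M))
    (X : Matrix ((A₂ × M) × ((A₁ × M) × B)) ((A₂ × M) × ((A₁ × M) × B)) ℂ) :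
    aliceAct (Φ.extend (memEquiv' A₁ M A₂ M) (memEquivSwap A₁ M A₂ M))
      (reindex (secondEquivSwap A₁ A₂ M B) (secondEquivSwap A₁ A₂ M B) X) =
      reindex (secondEquiv A₁ A₂ M B) (secondEquiv A₁ A₂ M B) (aliceAct Φ X) := by
  rw [aliceAct_eq Φ, ← krausMap_reindex' _ (secondEquivSwap A₁ A₂ M B)]
  refine congrArg (fun K : Φ.index → _ => krausMap K _) (funext fun i => ?_)
  ext ⟨⟨⟨a, c, n⟩, m⟩, b⟩ ⟨⟨⟨a', c', n'⟩, m'⟩, b'⟩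
  simp [Channel.extend, memEquiv', memEquiv, memEquivSwap, firstEquiv, secondEquiv,
    secondEquivSwap, one_apply, ← ite_and]
  grind

theorem aliceAct_secondEquiv (Φ : Channel (A₂ × M))
    (X : Matrix ((A₂ × M) × ((A₁ × M) × B)) ((A₂ × M) × ((A₁ × M) × B)) ℂ) :
    aliceAct (Φ.extend (memEquiv' A₁ M A₂ M) (memEquiv' A₁ M A₂ M))
      (reindex (secondEquiv A₁ A₂ M B) (secondEquiv A₁ A₂ M B) X) =
      reindex (secondEquiv A₁ A₂ M B) (secondEquiv A₁ A₂ M B) (aliceAct Φ X) := by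
  rw [aliceAct_eq Φ, ← krausMap_reindex]
  refine congrArg (fun K : Φ.index → _ => krausMap K _) (funext fun i => ?_)
  ext ⟨⟨⟨a, c, n⟩, m⟩, b⟩ ⟨⟨⟨a', c', n'⟩, m'⟩, b'⟩
  simp [Channel.extend, memEquiv', secondEquiv, one_apply, ← ite_and]
  grind

theorem bobAct_secondEquiv (Φ : Channel (M × B))
    (X : Matrix ((A₂ × M) × ((A₁ × M) × B)) ((A₂ × M) × ((A₁ × M) × B)) ℂ) :
    bobAct Φ (reindex (secondEquiv A₁ A₂ M B) (secondEquiv A₁ A₂ M B) X) =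
      reindex (secondEquiv A₁ A₂ M B) (secondEquiv A₁ A₂ M B)
        (bobAct (Φ.extend (bobMemEquiv A₁ M B) (bobMemEquiv A₁ M B)) X) := by
  rw [bobAct_eq, bobAct_eq, ← krausMap_reindex]
  refine congrArg (fun K : Φ.index → _ => krausMap K _) (funext fun i => ?_)
  ext ⟨⟨⟨a, c, n⟩, m⟩, b⟩ ⟨⟨⟨a', c', n'⟩, m'⟩, b'⟩
  simp [Channel.extend, onBob, bobMemEquiv, secondEquiv, one_apply, ← ite_and]
  grind

theorem aliceAct_prodAssoc (Φ : Channel (A₁ × M))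
    (X : Matrix ((A₁ × M) × B₁) ((A₁ × M) × B₁) ℂ) (τ : Matrix B₂ B₂ ℂ) :
    aliceAct Φ (reindex (Equiv.prodAssoc (A₁ × M) B₁ B₂) (Equiv.prodAssoc (A₁ × M) B₁ B₂) (X ⊗ₖ τ)) =
      reindex (Equiv.prodAssoc (A₁ × M) B₁ B₂) (Equiv.prodAssoc (A₁ × M) B₁ B₂)
        (aliceAct Φ X ⊗ₖ τ) := by
  rw [aliceAct_eq, aliceAct_eq, ← krausMap_kronecker, ← krausMap_reindex]
  refine congrArg (fun K : Φ.index → _ => krausMap K _) (funext fun i => ?_)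
  ext ⟨⟨a, m⟩, b, d⟩ ⟨⟨a', m'⟩, b', d'⟩
  simp [one_apply, ← ite_and]
  grind

theorem bobAct_prodAssoc (Φ : Channel (M × B₁))
    (X : Matrix ((A₁ × M) × B₁) ((A₁ × M) × B₁) ℂ) (τ : Matrix B₂ B₂ ℂ) :
    bobAct (Φ.extend (Equiv.prodAssoc M B₁ B₂) (Equiv.prodAssoc M B₁ B₂))
      (reindex (Equiv.prodAssoc (A₁ × M) B₁ B₂) (Equiv.prodAssoc (A₁ × M) B₁ B₂) (X ⊗ₖ τ)) =
      reindex (Equiv.prodAssoc (A₁ × M) B₁ B₂) (Equiv.prodAssoc (A₁ × M) B₁ B₂)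
        (bobAct Φ X ⊗ₖ τ) := by
  rw [bobAct_eq Φ, ← krausMap_kronecker, ← krausMap_reindex]
  refine congrArg (fun K : Φ.index → _ => krausMap K _) (funext fun i => ?_)
  ext ⟨⟨a, m⟩, b, d⟩ ⟨⟨a', m'⟩, b', d'⟩
  simp [Channel.extend, onBob, one_apply, ← ite_and]

theorem aliceAct_cheatEquiv (Φ : Channel (A₁ × M))
    (X : Matrix (((A₁ × B₁) × M) × B₂) (((A₁ × B₁) × M) × B₂) ℂ) :
    aliceAct Φ (reindex (cheatEquiv A₁ M B₁ B₂) (cheatEquiv A₁ M B₁ B₂) X) =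
      reindex (cheatEquiv A₁ M B₁ B₂) (cheatEquiv A₁ M B₁ B₂)
        (aliceAct (Φ.extend (cheatMemEquiv A₁ M B₁) (cheatMemEquiv A₁ M B₁)) X) := by
  rw [aliceAct_eq, aliceAct_eq, ← krausMap_reindex]
  refine congrArg (fun K : Φ.index → _ => krausMap K _) (funext fun i => ?_)
  ext ⟨⟨a, m⟩, b, d⟩ ⟨⟨a', m'⟩, b', d'⟩
  simp [Channel.extend, cheatEquiv, cheatMemEquiv, one_apply, ← ite_and]
  grind

theorem bobAct_cheatEquiv (Φ : Channel (M × B₂))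
    (X : Matrix (((A₁ × B₁) × M) × B₂) (((A₁ × B₁) × M) × B₂) ℂ) :
    bobAct (Φ.extend (bobEquiv M B₁ B₂) (bobEquiv M B₁ B₂))
      (reindex (cheatEquiv A₁ M B₁ B₂) (cheatEquiv A₁ M B₁ B₂) X) =
      reindex (cheatEquiv A₁ M B₁ B₂) (cheatEquiv A₁ M B₁ B₂) (bobAct Φ X) := by
  rw [bobAct_eq Φ, ← krausMap_reindex]
  refine congrArg (fun K : Φ.index → _ => krausMap K _) (funext fun i => ?_)
  ext ⟨⟨a, m⟩, b, d⟩ ⟨⟨a', m'⟩, b', d'⟩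
  simp [Channel.extend, onBob, cheatEquiv, bobEquiv, one_apply, ← ite_and]
  grind

theorem aliceAct_honestEquiv (Φ : Channel (A₂ × M))
    (X : Matrix ((A₂ × M) × B₂) ((A₂ × M) × B₂) ℂ) (τ : Matrix ((A₁ × M) × B₁) ((A₁ × M) × B₁) ℂ) :
    aliceAct Φ (reindex (honestEquiv A₁ A₂ M B₁ B₂) (honestEquiv A₁ A₂ M B₁ B₂) (X ⊗ₖ τ)) =
      reindex (honestEquiv A₁ A₂ M B₁ B₂) (honestEquiv A₁ A₂ M B₁ B₂) (aliceAct Φ X ⊗ₖ τ) := by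
  rw [aliceAct_eq, aliceAct_eq, ← krausMap_kronecker, ← krausMap_reindex]
  refine congrArg (fun K : Φ.index → _ => krausMap K _) (funext fun i => ?_)
  ext ⟨⟨c, m⟩, ⟨a, n⟩, b, d⟩ ⟨⟨c', m'⟩, ⟨a', n'⟩, b', d'⟩
  simp [honestEquiv, one_apply, ← ite_and]
  grind

theorem bobAct_honestEquiv (Φ : Channel (M × B₂))
    (X : Matrix ((A₂ × M) × B₂) ((A₂ × M) × B₂) ℂ) (τ : Matrix ((A₁ × M) × B₁) ((A₁ × M) × B₁) ℂ) :
    bobAct ((Φ.extend (bobEquiv M B₁ B₂) (bobEquiv M B₁ B₂)).extend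
        (bobMemEquiv A₁ M (B₁ × B₂)) (bobMemEquiv A₁ M (B₁ × B₂)))
      (reindex (honestEquiv A₁ A₂ M B₁ B₂) (honestEquiv A₁ A₂ M B₁ B₂) (X ⊗ₖ τ)) =
      reindex (honestEquiv A₁ A₂ M B₁ B₂) (honestEquiv A₁ A₂ M B₁ B₂) (bobAct Φ X ⊗ₖ τ) := by
  rw [bobAct_eq Φ, ← krausMap_kronecker, ← krausMap_reindex]
  refine congrArg (fun K : Φ.index → _ => krausMap K _) (funext fun i => ?_)
  ext ⟨⟨c, m⟩, ⟨a, n⟩, b, d⟩ ⟨⟨c', m'⟩, ⟨a', n'⟩, b', d'⟩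
  simp [Channel.extend, onBob, bobEquiv, bobMemEquiv, honestEquiv, one_apply, ← ite_and]

end Embedding

/-! ### Rewards and honest outputs of composed games -/

namespace Game

variable {M X Y : Type} [Fintype M] [DecidableEq M] [Fintype X] [Fintype Y]

theorem evo_seq_first_bob (G : Game M X) (H : Game M Y) {A : Type} [Fintype A] [DecidableEq A]
    (ρ : Matrix (A × M) (A × M) ℂ) (α : ℕ → Channel (A × M)) :
    evo α (G.seq H).stepB (ρ ⊗ₖ (G.seq H).initB.mat) G.rounds =
      reindex (Equiv.prodAssoc (A × M) G.memB H.memB) (Equiv.prodAssoc (A × M) G.memB H.memB)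
        (evo α G.stepB (ρ ⊗ₖ G.initB.mat) G.rounds ⊗ₖ H.initB.mat) := by
  have h0 : (ρ ⊗ₖ (G.seq H).initB.mat) =
      reindex (Equiv.prodAssoc (A × M) G.memB H.memB) (Equiv.prodAssoc (A × M) G.memB H.memB)
        ((ρ ⊗ₖ G.initB.mat) ⊗ₖ H.initB.mat) := (kronecker_assoc _ _ _).symm
  rw [h0]
  refine evo_map (fun Z => reindex (Equiv.prodAssoc (A × M) G.memB H.memB)
    (Equiv.prodAssoc (A × M) G.memB H.memB) (Z ⊗ₖ H.initB.mat)) _ ?_ ?_ _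
  · intro k _ Z
    exact aliceAct_prodAssoc _ _ _
  · intro k hk Z
    simp only [hk, if_true]
    exact bobAct_prodAssoc _ _ _

/-- Backward induction. During `H` Bob's register of `G` is idle, so its measurement may precede
`H`, and the register may be counted as Alice's memory. Given its outcome `x`, Alice plays `H` from
an unnormalized operator whose trace is the probability of `x`; this earns at most `g x` times that
probability, whatever the entanglement. So `g` serves as the reward in `G`. -/
theorem AliceBound.seq {G : Game M X} {H : Game M Y} {f : X × Y → ℝ} {g : X → ℝ} {v : ℝ}
    (hG : G.AliceBound g v) (hH : ∀ x, H.AliceBound (fun y => f (x, y)) (g x)) :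
    (G.seq H).AliceBound f v := by
  intro A _ _ ρ hρ α
  set S := evo α G.stepB (ρ ⊗ₖ G.initB.mat) G.rounds with hS
  set S' := reindex (cheatMemEquiv A M G.memB) (cheatMemEquiv A M G.memB) S with hS'
  let α' : ℕ → Channel ((A × G.memB) × M) := fun k =>
    (α (G.rounds + k)).extend (cheatMemEquiv A M G.memB) (cheatMemEquiv A M G.memB)
  have hS'pos : S'.PosSemidef :=
    reindex_posSemidef _ (evo_posSemidef _ _ (hρ.kronecker G.initB.posSemidef) _)
  have key : evo α (G.seq H).stepB (ρ ⊗ₖ (G.seq H).initB.mat) (G.rounds + H.rounds) =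
      reindex (cheatEquiv A M G.memB H.memB) (cheatEquiv A M G.memB H.memB)
        (evo α' H.stepB (S' ⊗ₖ H.initB.mat) H.rounds) := by
    rw [evo_add, evo_seq_first_bob]
    refine Eq.trans ?_ (evo_map (α' := fun k => α (G.rounds + k))
      (β' := fun k => (G.seq H).stepB (G.rounds + k)) (fun Z => reindex (cheatEquiv A M G.memB H.memB)
      (cheatEquiv A M G.memB H.memB) Z) _ ?_ ?_ _)
    · congr 1
    · intro k _ Z
      exact aliceAct_cheatEquiv _ _
    · intro k _ Z
      simpa [Game.seq] using bobAct_cheatEquiv (H.stepB k) Z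
  have step : ∀ x, ∑ y, f (x, y) * (((1 : Matrix (A × M) (A × M) ℂ) ⊗ₖ
      (G.outB.effect x ⊗ₖ H.outB.effect y)) *
        evo α (G.seq H).stepB (ρ ⊗ₖ (G.seq H).initB.mat) (G.rounds + H.rounds)).trace.re ≤
      g x * (((1 : Matrix (A × M) (A × M) ℂ) ⊗ₖ G.outB.effect x) * S).trace.re := by
    intro x
    obtain ⟨C, hC⟩ := exists_conjTranspose_mul_self (G.outB.posSemidef x)
    -- The measurement operator for Bob's outcome `x`, on the enlarged memory of Alice.
    set D : Matrix (A × G.memB) (A × G.memB) ℂ := (1 : Matrix A A ℂ) ⊗ₖ C with hD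
    have hDD : Dᴴ * D = (1 : Matrix A A ℂ) ⊗ₖ G.outB.effect x := by
      rw [hD, conjTranspose_kronecker, ← mul_kronecker_mul, hC, conjTranspose_one, one_mul]
    have hDre : D ⊗ₖ (1 : Matrix M M ℂ) = reindex (cheatMemEquiv A M G.memB)
        (cheatMemEquiv A M G.memB) ((1 : Matrix (A × M) (A × M) ℂ) ⊗ₖ C) := by
      ext ⟨⟨a, b⟩, m⟩ ⟨⟨a', b'⟩, m'⟩
      simp [hD, cheatMemEquiv, one_apply, ← ite_and]
      grind
    refine le_trans (le_of_eq ?_) ((hH x (A × G.memB) ((D ⊗ₖ 1) * S' * (D ⊗ₖ 1)ᴴ)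
      (hS'pos.mul_mul_conjTranspose_same _) α').trans_eq ?_)
    · refine Finset.sum_congr rfl fun y _ => ?_
      rw [← trace_evo_condition_alice, key, hDD]
      · have : (1 : Matrix (A × M) (A × M) ℂ) ⊗ₖ (G.outB.effect x ⊗ₖ H.outB.effect y) =
            reindex (cheatEquiv A M G.memB H.memB) (cheatEquiv A M G.memB H.memB)
              ((((1 : Matrix A A ℂ) ⊗ₖ G.outB.effect x) ⊗ₖ (1 : Matrix M M ℂ)) ⊗ₖ
                H.outB.effect y) := by
          ext ⟨⟨a, m⟩, b, d⟩ ⟨⟨a', m'⟩, b', d'⟩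
          simp [cheatEquiv, one_apply, ← ite_and]
          grind
        rw [this, ← reindex_mul, trace_reindex]
      · intro k i
        rw [hDre]
        simp only [α', Channel.extend]
        rw [← reindex_mul, ← reindex_mul, ← mul_kronecker_mul, ← mul_kronecker_mul]
        simp
    · rw [← trace_conjTranspose_mul_mul, conjTranspose_kronecker, ← mul_kronecker_mul, hDD, hS']
      have : ((1 : Matrix A A ℂ) ⊗ₖ G.outB.effect x) ⊗ₖ ((1 : Matrix M M ℂ)ᴴ * 1) =
          reindex (cheatMemEquiv A M G.memB) (cheatMemEquiv A M G.memB)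
            ((1 : Matrix (A × M) (A × M) ℂ) ⊗ₖ G.outB.effect x) := by
        ext ⟨⟨a, b⟩, m⟩ ⟨⟨a', b'⟩, m'⟩
        simp [cheatMemEquiv, one_apply, ← ite_and]
        grind
      rw [this, ← reindex_mul, trace_reindex]
  rw [Fintype.sum_prod_type]
  exact (Finset.sum_le_sum fun x _ => step x).trans (hG A ρ hρ α)

theorem evo_seq_first_alice (G : Game M X) (H : Game M Y) {B : Type} [Fintype B] [DecidableEq B]
    (σ : Matrix B B ℂ) (β : ℕ → Channel (M × B)) :
    evo (G.seq H).stepA β ((G.seq H).initA.mat ⊗ₖ σ) G.rounds =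
      reindex (firstEquiv G.memA H.memA M B) (firstEquiv G.memA H.memA M B)
        (evo G.stepA β (G.initA.mat ⊗ₖ σ) G.rounds ⊗ₖ H.initA.mat) := by
  have h0 : ((G.seq H).initA.mat ⊗ₖ σ) =
      reindex (firstEquiv G.memA H.memA M B) (firstEquiv G.memA H.memA M B)
        ((G.initA.mat ⊗ₖ σ) ⊗ₖ H.initA.mat) := by
    ext ⟨⟨⟨a, c, n⟩, m⟩, b⟩ ⟨⟨⟨a', c', n'⟩, m'⟩, b'⟩
    simp [seq, DensityOp.prod, DensityOp.reindex, memEquiv, firstEquiv]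
    ring
  rw [h0]
  refine evo_map (fun Z => reindex (firstEquiv G.memA H.memA M B) (firstEquiv G.memA H.memA M B)
    (Z ⊗ₖ H.initA.mat)) _ ?_ ?_ _
  · intro k hk Z
    simp only [hk, if_true]
    exact aliceAct_firstEquiv _ _ _
  · intro k hk Z
    exact bobAct_firstEquiv _ _ _

/-- In the second game all that is left of the first, including Alice's idle registers, counts as
memory of Bob. Positivity of `H.rounds` guarantees that Alice has exchanged the message registers.
-/
theorem evo_seq_alice (G : Game M X) (H : Game M Y) (hH : 0 < H.rounds) {B : Type} [Fintype B]
    [DecidableEq B] (σ : Matrix B B ℂ) (β : ℕ → Channel (M × B)) :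
    evo (G.seq H).stepA β ((G.seq H).initA.mat ⊗ₖ σ) (G.rounds + H.rounds) =
      reindex (secondEquiv G.memA H.memA M B) (secondEquiv G.memA H.memA M B)
        (evo H.stepA (fun k => (β (G.rounds + k)).extend (bobMemEquiv G.memA M B)
          (bobMemEquiv G.memA M B))
          (H.initA.mat ⊗ₖ evo G.stepA β (G.initA.mat ⊗ₖ σ) G.rounds) H.rounds) := by
  rw [evo_add, evo_seq_first_alice]
  refine Eq.trans ?_ (evo_map_first (α' := fun k => (G.seq H).stepA (G.rounds + k))
      (β' := fun k => β (G.rounds + k)) (fun Z => reindex (secondEquivSwap G.memA H.memA M B)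
      (secondEquivSwap G.memA H.memA M B) Z) (fun Z => reindex (secondEquiv G.memA H.memA M B)
      (secondEquiv G.memA H.memA M B) Z) hH ?_ ?_ ?_ _)
  · congr 1
    ext ⟨⟨⟨a, c, n⟩, m⟩, b⟩ ⟨⟨⟨a', c', n'⟩, m'⟩, b'⟩
    simp [secondEquivSwap, firstEquiv, mul_comm]
  · intro Z
    simpa [Game.seq] using aliceAct_secondEquivSwap (H.stepA 0) Z
  · intro k hk Z
    have h : G.rounds + k ≠ G.rounds := by omega
    simpa [Game.seq, hk.ne'] using aliceAct_secondEquiv (H.stepA k) Z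
  · intro k Z
    exact bobAct_secondEquiv _ _

/-- The mirror image of `AliceBound.seq`: Alice's registers of `G` are idle during `H`, are measured
first and join Bob's memory. -/
theorem BobBound.seq {G : Game M X} {H : Game M Y} (hr : 0 < H.rounds) {f : X × Y → ℝ}
    {g : X → ℝ} {v : ℝ} (hG : G.BobBound g v) (hH : ∀ x, H.BobBound (fun y => f (x, y)) (g x)) :
    (G.seq H).BobBound f v := by
  intro B _ _ σ hσ β
  set S := evo G.stepA β (G.initA.mat ⊗ₖ σ) G.rounds with hS
  have hSpos : S.PosSemidef := evo_posSemidef _ _ (G.initA.posSemidef.kronecker hσ) _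
  have step : ∀ x, ∑ y, f (x, y) * (((G.seq H).outA.effect (x, y) ⊗ₖ (1 : Matrix B B ℂ)) *
        evo (G.seq H).stepA β ((G.seq H).initA.mat ⊗ₖ σ) (G.rounds + H.rounds)).trace.re ≤
      g x * ((G.outA.effect x ⊗ₖ (1 : Matrix B B ℂ)) * S).trace.re := by
    intro x
    obtain ⟨C, hC⟩ := exists_conjTranspose_mul_self (G.outA.posSemidef x)
    set D : Matrix ((G.memA × M) × B) ((G.memA × M) × B) ℂ := C ⊗ₖ (1 : Matrix B B ℂ) with hD
    have hDD : Dᴴ * D = G.outA.effect x ⊗ₖ (1 : Matrix B B ℂ) := by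
      rw [hD, conjTranspose_kronecker, ← mul_kronecker_mul, hC, conjTranspose_one, one_mul]
    have hDre : (1 : Matrix M M ℂ) ⊗ₖ D = reindex (bobMemEquiv G.memA M B)
        (bobMemEquiv G.memA M B) ((1 : Matrix (M × B) (M × B) ℂ) ⊗ₖ C) := by
      ext ⟨m, ⟨a, n⟩, b⟩ ⟨m', ⟨a', n'⟩, b'⟩
      simp [hD, bobMemEquiv, one_apply, ← ite_and]
      grind
    refine le_trans (le_of_eq ?_) ((hH x ((G.memA × M) × B) (D * S * Dᴴ)
      (hSpos.mul_mul_conjTranspose_same _) (fun k => (β (G.rounds + k)).extend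
        (bobMemEquiv G.memA M B) (bobMemEquiv G.memA M B))).trans_eq ?_)
    · refine Finset.sum_congr rfl fun y _ => ?_
      rw [← trace_evo_condition_bob, evo_seq_alice G H hr, hDD]
      · have : (G.seq H).outA.effect (x, y) ⊗ₖ (1 : Matrix B B ℂ) =
            reindex (secondEquiv G.memA H.memA M B) (secondEquiv G.memA H.memA M B)
              (H.outA.effect y ⊗ₖ (G.outA.effect x ⊗ₖ (1 : Matrix B B ℂ))) := by
          ext ⟨⟨⟨a, c, n⟩, m⟩, b⟩ ⟨⟨⟨a', c', n'⟩, m'⟩, b'⟩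
          simp [Game.seq, Measurement.prod, Measurement.reindex, memEquiv', secondEquiv]
          grind
        rw [this, ← reindex_mul, trace_reindex]
      · intro k i
        rw [hDre]
        simp only [Channel.extend]
        rw [← reindex_mul, ← reindex_mul, ← mul_kronecker_mul, ← mul_kronecker_mul]
        simp
    · rw [← trace_conjTranspose_mul_mul, hDD]
  rw [Fintype.sum_prod_type]
  exact (Finset.sum_le_sum fun x _ => step x).trans (hG B σ hσ β)

/-- Honest players carry nothing over from `G` to `H`, so the final operator and the effects are
both tensor products. -/
theorem joint_seq (G : Game M X) (H : Game M Y) (hr : 0 < H.rounds) (x x' : X) (y y' : Y) :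
    (G.seq H).joint (x, y) (x', y') = G.joint x x' * H.joint y y' := by
  set S := evo G.stepA G.stepB (G.initA.mat ⊗ₖ G.initB.mat) G.rounds with hS
  have key : evo (G.seq H).stepA (G.seq H).stepB
      ((G.seq H).initA.mat ⊗ₖ (G.seq H).initB.mat) (G.rounds + H.rounds) =
      reindex (secondEquiv G.memA H.memA M _) (secondEquiv G.memA H.memA M _)
        (reindex (honestEquiv G.memA H.memA M G.memB H.memB) (honestEquiv _ _ _ _ _)
          (evo H.stepA H.stepB (H.initA.mat ⊗ₖ H.initB.mat) H.rounds ⊗ₖ S)) := by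
    rw [evo_seq_alice G H hr, evo_seq_first_bob]
    congr 1
    refine Eq.trans ?_ (evo_map (α' := H.stepA)
      (β' := fun k => ((G.seq H).stepB (G.rounds + k)).extend
        (bobMemEquiv G.memA M (G.memB × H.memB)) (bobMemEquiv G.memA M (G.memB × H.memB)))
      (fun Z => reindex (honestEquiv G.memA H.memA M G.memB H.memB)
      (honestEquiv _ _ _ _ _) (Z ⊗ₖ S)) _ ?_ ?_ _)
    · congr 1
      ext ⟨⟨c, m⟩, ⟨a, n⟩, b, d⟩ ⟨⟨c', m'⟩, ⟨a', n'⟩, b', d'⟩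
      simp [honestEquiv, hS]
      ring
    · intro k _ Z
      exact aliceAct_honestEquiv _ _ _
    · intro k _ Z
      simpa [Game.seq] using bobAct_honestEquiv (H.stepB k) Z S
  have : (G.seq H).outA.effect (x, y) ⊗ₖ (G.seq H).outB.effect (x', y') =
      reindex (secondEquiv G.memA H.memA M _) (secondEquiv G.memA H.memA M _)
        (reindex (honestEquiv G.memA H.memA M G.memB H.memB) (honestEquiv _ _ _ _ _)
          ((H.outA.effect y ⊗ₖ H.outB.effect y') ⊗ₖ (G.outA.effect x ⊗ₖ G.outB.effect x'))) := by
    ext ⟨⟨⟨a, c, n⟩, m⟩, b, d⟩ ⟨⟨⟨a', c', n'⟩, m'⟩, b', d'⟩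
    simp [Game.seq, Measurement.prod, Measurement.reindex, memEquiv', secondEquiv, honestEquiv]
    ring
  have hrounds : (G.seq H).rounds = G.rounds + H.rounds := rfl
  rw [joint, hrounds, this, key, ← reindex_mul, trace_reindex, ← reindex_mul, trace_reindex,
    ← mul_kronecker_mul, trace_kronecker, mul_comm]
  rfl

end Game

/-! ### Classical states and permutations of basis states -/

section Classical

variable {A M B n X : Type} [Fintype A] [DecidableEq A] [Fintype M] [DecidableEq M]
  [Fintype B] [DecidableEq B] [Fintype n] [DecidableEq n] [Fintype X] [DecidableEq X]

/-- A probability distribution on basis states. -/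
noncomputable def DensityOp.diagonal (p : n → ℝ) (hp : ∀ i, 0 ≤ p i) (hs : ∑ i, p i = 1) :
    DensityOp n where
  mat := Matrix.diagonal fun i => (p i : ℂ)
  posSemidef := PosSemidef.diagonal fun i => by simpa using hp i
  trace_eq_one := by rw [trace_diagonal]; exact_mod_cast hs

/-- Measurement in the standard basis. -/
def Measurement.standard (φ : n → X) : Measurement X n where
  effect x := Matrix.diagonal fun i => if φ i = x then 1 else 0
  posSemidef x := PosSemidef.diagonal fun i => by
    simp only [Pi.zero_apply]
    split_ifs <;> simp
  sum_eq_one := by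
    ext i j
    rcases eq_or_ne i j with rfl | h
    · simp [Matrix.sum_apply]
    · simp [Matrix.sum_apply, h]

/-- The unitary channel that permutes the basis states. -/
def Channel.perm (σ : Equiv.Perm n) : Channel n where
  index := Unit
  kraus _ := reindex σ (Equiv.refl n) 1
  trace_preserving := by
    simp only [reindex_apply, conjTranspose_submatrix, Finset.univ_unique, Finset.sum_singleton,
      submatrix_mul_equiv, conjTranspose_one, one_mul]
    simp

theorem aliceAct_id (ρ : Matrix ((A × M) × B) ((A × M) × B) ℂ) :
    aliceAct (Channel.id (A × M)) ρ = ρ := by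
  simp [aliceAct_eq, krausMap, Channel.id]

/-- The action of a permutation of the basis states of the message and Bob's memory. -/
def bobPerm (A : Type) (σ : Equiv.Perm (M × B)) : Equiv.Perm ((A × M) × B) where
  toFun x := ((x.1.1, (σ (x.1.2, x.2)).1), (σ (x.1.2, x.2)).2)
  invFun x := ((x.1.1, (σ.symm (x.1.2, x.2)).1), (σ.symm (x.1.2, x.2)).2)
  left_inv x := by simp
  right_inv x := by simp

theorem bobAct_perm (σ : Equiv.Perm (M × B)) (ρ : Matrix ((A × M) × B) ((A × M) × B) ℂ) :
    bobAct (Channel.perm σ) ρ = reindex (bobPerm A σ) (bobPerm A σ) ρ := by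
  have h1 : (fun _ : Unit => reindex (bobPerm A σ) (Equiv.refl _) (1 : Matrix ((A × M) × B) _ ℂ)) =
      fun i => onBob ((Channel.perm σ).kraus i) := by
    funext _
    ext ⟨⟨a, m⟩, b⟩ ⟨⟨a', m'⟩, b'⟩
    simp [onBob, Channel.perm, bobPerm, one_apply, ← ite_and, Prod.ext_iff, and_assoc]
    grind
  have h2 := krausMap_reindex' (bobPerm A σ) (Equiv.refl _) (fun _ : Unit => 1) ρ
  rw [h1] at h2
  exact h2.trans (by simp [krausMap])

/-- All operators stay diagonal, so a one-round exchange of classical data reduces to a finite sum.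
-/
theorem trace_diagonal_mul_perm (σ : Equiv.Perm (M × B)) (d v : A × M → ℂ) (d' v' : B → ℂ) :
    ((Matrix.diagonal d ⊗ₖ Matrix.diagonal d') * bobAct (Channel.perm σ)
      (aliceAct (Channel.id (A × M)) (Matrix.diagonal v ⊗ₖ Matrix.diagonal v'))).trace =
      ∑ i, d (bobPerm A σ i).1 * d' (bobPerm A σ i).2 * (v i.1 * v' i.2) := by
  rw [aliceAct_id, bobAct_perm, diagonal_kronecker_diagonal, diagonal_kronecker_diagonal]
  have : reindex (bobPerm A σ) (bobPerm A σ) (Matrix.diagonal fun i => v i.1 * v' i.2) =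
      Matrix.diagonal ((fun i => v i.1 * v' i.2) ∘ (bobPerm A σ).symm) := by
    simp
  rw [this, diagonal_mul_diagonal, trace_diagonal, ← Equiv.sum_comp (bobPerm A σ)]
  simp

end Classical

/-! ### Outputs that a cheater cannot influence -/

namespace Game

variable {M X : Type} [Fintype M] [DecidableEq M] [Fintype X]

/-- If Bob's measurement commutes with his operations, Alice cannot influence its outcome. -/
theorem aliceBound_of_commute (G : Game M X) (f : X → ℝ)
    (h : ∀ k i y, ((1 : Matrix M M ℂ) ⊗ₖ G.outB.effect y) * (G.stepB k).kraus i =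
      (G.stepB k).kraus i * (1 ⊗ₖ G.outB.effect y)) :
    G.AliceBound f (∑ y, f y * (G.outB.effect y * G.initB.mat).trace.re) := by
  intro A _ _ ρ hρ α
  rw [Finset.sum_mul]
  refine le_of_eq (Finset.sum_congr rfl fun y _ => ?_)
  rw [trace_mul_evo, ← mul_kronecker_mul, one_mul, trace_kronecker]
  · have := (Complex.nonneg_iff.mp hρ.trace_nonneg).2
    rw [Complex.mul_re, ← this]
    ring
  · intro k i
    rw [← mul_kronecker_mul, ← mul_kronecker_mul]
    simp
  · intro k i
    have : (1 : Matrix (A × M) (A × M) ℂ) ⊗ₖ G.outB.effect y =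
        onBob ((1 : Matrix M M ℂ) ⊗ₖ G.outB.effect y) := by
      ext ⟨⟨a, m⟩, b⟩ ⟨⟨a', m'⟩, b'⟩
      simp [onBob, one_apply, ← ite_and, and_comm]
    rw [this, ← onBob_mul, ← onBob_mul, h]

/-- If Alice measures only her memory and her operations are trivial, Bob cannot influence
the outcome. -/
theorem bobBound_of_commute (G : Game M X) (f : X → ℝ) (E : X → Matrix G.memA G.memA ℂ)
    (hE : ∀ x, G.outA.effect x = E x ⊗ₖ (1 : Matrix M M ℂ))
    (h : ∀ k, G.stepA k = Channel.id _) :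
    G.BobBound f (∑ x, f x * (G.outA.effect x * G.initA.mat).trace.re) := by
  intro B _ _ σ hσ β
  rw [Finset.sum_mul]
  refine le_of_eq (Finset.sum_congr rfl fun x _ => ?_)
  rw [trace_mul_evo, ← mul_kronecker_mul, one_mul, trace_kronecker]
  · have := (Complex.nonneg_iff.mp hσ.trace_nonneg).2
    rw [Complex.mul_re, ← this]
    ring
  · intro k i
    have : ∀ Φ : Channel (G.memA × M), Φ = Channel.id _ → ∀ i, Φ.kraus i = 1 := by
      rintro _ rfl _
      rfl
    rw [this _ (h k)]
    simp
  · intro k i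
    have : G.outA.effect x ⊗ₖ (1 : Matrix B B ℂ) =
        reindex (Equiv.prodAssoc G.memA M B).symm (Equiv.prodAssoc G.memA M B).symm
          (E x ⊗ₖ (1 : Matrix (M × B) (M × B) ℂ)) := by
      rw [hE]
      ext ⟨⟨a, m⟩, b⟩ ⟨⟨a', m'⟩, b'⟩
      simp [one_apply, ← ite_and, and_comm]
    rw [this, onBob, ← reindex_mul, ← reindex_mul, ← mul_kronecker_mul, ← mul_kronecker_mul]
    simp

end Game

/-! ### Sending one random bit -/

section Bits

variable {M : Type} [Fintype M] [DecidableEq M]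

/-- The message that carries a bit. -/
def enc (m₀ m₁ : M) (b : Bool) : M := if b then m₁ else m₀

/-- Bob adds the bit carried by the message to his memory. -/
def readPerm (m₁ : M) : Equiv.Perm (M × Bool) where
  toFun x := (x.1, xor x.2 (decide (x.1 = m₁)))
  invFun x := (x.1, xor x.2 (decide (x.1 = m₁)))
  left_inv x := by simp
  right_inv x := by simp

/-- Bob writes the bit in his memory into the message. -/
def writePerm (m₀ m₁ : M) : Equiv.Perm (M × Bool) where
  toFun x := (if x.2 then Equiv.swap m₀ m₁ x.1 else x.1, x.2)
  invFun x := (if x.2 then Equiv.swap m₀ m₁ x.1 else x.1, x.2)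
  left_inv x := by rcases x with ⟨m, _ | _⟩ <;> simp
  right_inv x := by rcases x with ⟨m, _ | _⟩ <;> simp

/-- Alice tells Bob a uniformly random bit. -/
noncomputable abbrev aliceBit (m₀ m₁ : M) : Game M Bool where
  rounds := 1
  memA := Bool
  memB := Bool
  initA := DensityOp.diagonal (fun z => if z.2 = enc m₀ m₁ z.1 then 1 / 2 else 0)
    (fun z => by split_ifs <;> norm_num) (by simp [Fintype.sum_prod_type])
  initB := DensityOp.diagonal (fun b => if b then 0 else 1)
    (fun b => by split_ifs <;> norm_num) (by simp)
  stepA _ := Channel.id _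
  stepB _ := Channel.perm (readPerm m₁)
  outA := Measurement.standard fun z => z.1
  outB := Measurement.standard fun b => b

/-- Bob tells Alice a random bit that is `true` with probability `s`. -/
noncomputable abbrev bobBit (m₀ m₁ : M) (s : ℝ) (h₀ : 0 ≤ s) (h₁ : s ≤ 1) : Game M Bool where
  rounds := 1
  memA := Unit
  memB := Bool
  initA := DensityOp.diagonal (fun z => if z.2 = m₀ then 1 else 0)
    (fun z => by split_ifs <;> norm_num) (by rw [Fintype.sum_prod_type]; simp)
  initB := DensityOp.diagonal (fun b => if b then s else 1 - s)
    (fun b => by split_ifs <;> linarith) (by simp)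
  stepA _ := Channel.id _
  stepB _ := Channel.perm (writePerm m₀ m₁)
  outA := Measurement.standard fun z => decide (z.2 = m₁)
  outB := Measurement.standard fun b => b

theorem joint_aliceBit {m₀ m₁ : M} (h : m₀ ≠ m₁) (x y : Bool) :
    (aliceBit m₀ m₁).joint x y = if x = y then 1 / 2 else 0 := by
  have := trace_diagonal_mul_perm (A := Bool) (readPerm m₁)
    (fun i => if i.1 = x then 1 else 0)
    (fun i => ((if i.2 = enc m₀ m₁ i.1 then 1 / 2 else 0 : ℝ) : ℂ))
    (fun b => if b = y then 1 else 0) (fun b => ((if b then 0 else 1 : ℝ) : ℂ))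
  refine Eq.trans this ?_
  simp only [Fintype.sum_prod_type, bobPerm, readPerm, Fintype.sum_bool]
  cases x <;> cases y <;> simp [enc, h.symm]
  · rw [Fintype.sum_eq_single m₀ (by intro m hm; simp [hm])]
    simp [h]
  · exact Finset.sum_eq_zero fun m _ => by split_ifs <;> simp

theorem joint_bobBit {m₀ m₁ : M} (h : m₀ ≠ m₁) (s : ℝ) (h₀ : 0 ≤ s) (h₁ : s ≤ 1) (x y : Bool) :
    (bobBit m₀ m₁ s h₀ h₁).joint x y =
      if x = y then ((if x then s else 1 - s : ℝ) : ℂ) else 0 := by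
  have := trace_diagonal_mul_perm (A := Unit) (writePerm m₀ m₁)
    (fun i => if decide (i.2 = m₁) = x then 1 else 0)
    (fun i => ((if i.2 = m₀ then 1 else 0 : ℝ) : ℂ))
    (fun b => if b = y then 1 else 0) (fun b => ((if b then s else 1 - s : ℝ) : ℂ))
  refine Eq.trans this ?_
  simp only [Fintype.sum_prod_type, bobPerm, writePerm, Fintype.sum_bool]
  cases x <;> cases y <;> simp [h.symm]
  all_goals
    rw [Fintype.sum_eq_single m₀ (by intro m hm; simp [hm])]
    simp [h]

/-- Alice outputs the copy of the bit in her memory, which is out of Bob's reach. -/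
theorem bobBound_aliceBit (m₀ m₁ : M) (f : Bool → ℝ) :
    (aliceBit m₀ m₁).BobBound f ((f true + f false) / 2) := by
  refine ((aliceBit m₀ m₁).bobBound_of_commute f
    (fun x => Matrix.diagonal fun c : Bool => if c = x then 1 else 0) (fun x => ?_)
    (fun _ => rfl)).mono (fun _ => le_rfl) (le_of_eq ?_)
  · rw [← diagonal_one, diagonal_kronecker_diagonal]
    simp [aliceBit, Measurement.standard]
  · simp only [Measurement.standard, DensityOp.diagonal, diagonal_mul_diagonal,
      trace_diagonal, Fintype.sum_prod_type, Fintype.sum_bool]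
    simp
    ring

/-- Bob's bit only controls a permutation of the message, hence is conserved whatever Alice sends.
-/
theorem aliceBound_bobBit (m₀ m₁ : M) (s : ℝ) (h₀ : 0 ≤ s) (h₁ : s ≤ 1) (f : Bool → ℝ) :
    (bobBit m₀ m₁ s h₀ h₁).AliceBound f (f true * s + f false * (1 - s)) := by
  refine ((bobBit m₀ m₁ s h₀ h₁).aliceBound_of_commute f (fun k i y => ?_)).mono
    (fun _ => le_rfl) (le_of_eq ?_)
  · simp only [← diagonal_one, Measurement.standard, diagonal_kronecker_diagonal]
    ext ⟨m, b⟩ ⟨m', b'⟩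
    simp only [diagonal_mul, mul_diagonal, Channel.perm, reindex_apply, submatrix_apply, one_apply]
    rcases b with _ | _ <;> rcases b' with _ | _ <;> simp [writePerm]
    all_goals grind
  · simp only [Measurement.standard, DensityOp.diagonal, diagonal_mul_diagonal,
      trace_diagonal, Fintype.sum_bool]
    simp

end Bits

/-! ### Protocols as games -/

theorem outcomeProb_some {M : Type} [Fintype M] [DecidableEq M] (N : ℕ) (a : AliceStrategy M)
    (b : BobStrategy M) (v : Fin 2) :
    outcomeProb N a b (some v) = jointProb N a b (some v) (some v) := by
  have : ∀ x y : Outcome, combine x y = some v ↔ x = some v ∧ y = some v := by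
    intro x y
    unfold combine
    split_ifs with h
    · subst h; simp
    · simp only [false_iff, not_and]
      rintro rfl rfl
      exact h rfl
  simp only [outcomeProb, this]
  rw [Fintype.sum_eq_single (some v) (fun x hx => by simp [hx]),
    Fintype.sum_eq_single (some v) (fun y hy => by simp [hy])]
  simp

/-- The game played by the honest players of a protocol. -/
abbrev Protocol.game (P : Protocol) : Game P.Msg Outcome where
  rounds := P.rounds
  memA := P.alice.mem
  memB := P.bob.mem
  initA := P.alice.init
  initB := P.bob.init
  stepA := P.alice.step
  stepB := P.bob.step
  outA := P.alice.output
  outB := P.bob.output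

/-! ### Reduction to normalized states -/

section Normalize

variable {A M B n : Type} [Fintype A] [DecidableEq A] [Fintype M] [DecidableEq M]
  [Fintype B] [DecidableEq B] [Fintype n] [DecidableEq n]

theorem evo_smul (α : ℕ → Channel (A × M)) (β : ℕ → Channel (M × B)) (c : ℂ)
    (ρ : Matrix ((A × M) × B) ((A × M) × B) ℂ) (k : ℕ) :
    evo α β (c • ρ) k = c • evo α β ρ k := by
  refine evo_map (fun Z => c • Z) k ?_ ?_ ρ
  · intro k _ Z
    simp [aliceAct_eq, krausMap, Finset.smul_sum]
  · intro k _ Z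
    simp [bobAct_eq, krausMap, Finset.smul_sum]

/-- A positive operator is a nonnegative multiple of a density operator. -/
theorem exists_eq_smul_densityOp {ρ : Matrix n n ℂ} (h : ρ.PosSemidef) :
    ρ = 0 ∨ ∃ σ : DensityOp n, ρ = ((ρ.trace.re : ℝ) : ℂ) • σ.mat := by
  rcases eq_or_ne ρ.trace 0 with h0 | h0
  · exact Or.inl (h.trace_eq_zero_iff.mp h0)
  · have him := (Complex.nonneg_iff.mp h.trace_nonneg).2
    have hre : ((ρ.trace.re : ℝ) : ℂ) = ρ.trace := Complex.ext rfl him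
    refine Or.inr ⟨⟨ρ.trace⁻¹ • ρ, h.smul ?_, ?_⟩, ?_⟩
    · exact inv_nonneg.mpr h.trace_nonneg
    · rw [trace_smul, smul_eq_mul, inv_mul_cancel₀ h0]
    · rw [hre, smul_smul, mul_inv_cancel₀ h0, one_smul]

end Normalize

/-! ### What a balanced weak coin flip provides -/

section WCF

variable {P : Protocol} {z ε : ℝ}

/-- A cheating Alice may always announce `some 0`; the outcome is then `0` exactly when Bob outputs
`0`. Linearity of the run extends the bound to unnormalized operators. -/
theorem IsWCF.aliceBound (h : IsWCF P z ε) :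
    P.game.AliceBound (fun y => if y = some 0 then 1 else 0) (z + ε) := by
  intro A _ _ ρ hρ α
  rw [Fintype.sum_eq_single (some 0) (fun y hy => by simp [hy])]
  simp only [if_true, one_mul]
  rcases exists_eq_smul_densityOp hρ with rfl | ⟨σ, hσ⟩
  · have := evo_smul α P.game.stepB 0 (0 ⊗ₖ P.game.initB.mat) P.game.rounds
    simp only [zero_smul, zero_kronecker] at this
    simp [this]
  · have key := h.alice_cheats
      { mem := A, init := σ, step := α, output := Measurement.standard fun _ => some 0 }
    rw [Protocol.prob, outcomeProb_some, jointProb, state_eq_evo] at key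
    simp only [Measurement.standard, if_true, diagonal_one] at key
    rw [hσ, smul_kronecker, evo_smul, Matrix.mul_smul, trace_smul, smul_eq_mul, Complex.re_ofReal_mul,
      ← hσ, mul_comm]
    exact mul_le_mul_of_nonneg_right key (Complex.nonneg_iff.mp hρ.trace_nonneg).1

theorem IsWCF.bobBound (h : IsWCF P z ε) :
    P.game.BobBound (fun x => if x = some 1 then 1 else 0) (1 - z + ε) := by
  intro B _ _ ρ hρ β
  rw [Fintype.sum_eq_single (some 1) (fun y hy => by simp [hy])]
  simp only [if_true, one_mul]
  rcases exists_eq_smul_densityOp hρ with rfl | ⟨σ, hσ⟩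
  · have := evo_smul P.game.stepA β 0 (P.game.initA.mat ⊗ₖ 0) P.game.rounds
    simp only [zero_smul, kronecker_zero] at this
    simp [this]
  · have key := h.bob_cheats
      { mem := B, init := σ, step := β, output := Measurement.standard fun _ => some 1 }
    rw [Protocol.prob, outcomeProb_some, jointProb, state_eq_evo] at key
    simp only [Measurement.standard, if_true, diagonal_one] at key
    rw [hσ, kronecker_smul, evo_smul, Matrix.mul_smul, trace_smul, smul_eq_mul, Complex.re_ofReal_mul,
      ← hσ, mul_comm]
    exact mul_le_mul_of_nonneg_right key (Complex.nonneg_iff.mp hρ.trace_nonneg).1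

theorem Game.joint_nonneg {M X : Type} [Fintype M] [DecidableEq M] [Fintype X] (G : Game M X)
    (x y : X) : 0 ≤ G.joint x y :=
  trace_mul_nonneg ((G.outA.posSemidef x).kronecker (G.outB.posSemidef y))
    (evo_posSemidef _ _ (G.initA.posSemidef.kronecker G.initB.posSemidef) _)

theorem Game.sum_joint {M X : Type} [Fintype M] [DecidableEq M] [Fintype X] (G : Game M X) :
    ∑ x, ∑ y, G.joint x y = 1 := by
  simp only [Game.joint, ← trace_sum, ← Finset.sum_mul, ← kronecker_sum, ← sum_kronecker]
  rw [G.outA.sum_eq_one, G.outB.sum_eq_one, one_kronecker_one, one_mul, trace_evo, trace_kronecker,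
    G.initA.trace_eq_one, G.initB.trace_eq_one, one_mul]

theorem Protocol.prob_honest (P : Protocol) (v : Fin 2) :
    P.prob P.alice P.bob (some v) = (P.game.joint (some v) (some v)).re := by
  rw [Protocol.prob, outcomeProb_some, jointProb, state_eq_evo]
  rfl

/-- The two agreeing outcomes already have total probability `1`, and all entries are nonnegative,
so the others vanish. -/
theorem IsWCF.joint (h : IsWCF P (1 / 2) ε) (x y : Outcome) :
    P.game.joint x y = if x = y ∧ x ≠ none then 1 / 2 else 0 := by
  have h0 := h.honest_alice_wins
  have h1 := h.honest_bob_wins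
  rw [Protocol.prob_honest] at h0 h1
  have him : ∀ x y, (P.game.joint x y).im = 0 := fun x y =>
    ((Complex.nonneg_iff.mp (P.game.joint_nonneg x y)).2).symm
  have hre : ∀ x y, 0 ≤ (P.game.joint x y).re := fun x y =>
    (Complex.nonneg_iff.mp (P.game.joint_nonneg x y)).1
  have hs := congrArg Complex.re P.game.sum_joint
  simp only [Fintype.sum_option, Fin.sum_univ_two, Complex.add_re, Complex.one_re] at hs
  have n00 := hre none none
  have n01 := hre none (some 0)
  have n02 := hre none (some 1)
  have n10 := hre (some 0) none
  have n12 := hre (some 0) (some 1)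
  have n20 := hre (some 1) none
  have n21 := hre (some 1) (some 0)
  refine Complex.ext ?_ ?_
  · rcases x with _ | x <;> rcases y with _ | y
    · simp
      linarith
    · fin_cases y <;> simp <;> linarith
    · fin_cases x <;> simp <;> linarith
    · fin_cases x <;> fin_cases y <;> simp <;> linarith
  · rw [him]
    split_ifs <;> simp

/-- The outputs of two players who do not communicate are independent. -/
theorem Game.joint_eq_mul_of_trivial {M X : Type} [Fintype M] [DecidableEq M] [Fintype X]
    (G : Game M X) (h : G.rounds = 0 ∨ Subsingleton M) :
    ∃ p q : X → ℂ, ∀ x y, G.joint x y = p x * q y := by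
  have hev : ∃ (S : Matrix (G.memA × M) (G.memA × M) ℂ) (T : Matrix G.memB G.memB ℂ),
      evo G.stepA G.stepB (G.initA.mat ⊗ₖ G.initB.mat) G.rounds = S ⊗ₖ T := by
    rcases h with h | h
    · rw [h]
      exact ⟨_, _, rfl⟩
    · have hne : Nonempty (G.memA × M) := by
        by_contra hc
        rw [not_nonempty_iff] at hc
        simpa [Matrix.trace] using G.initA.trace_eq_one
      obtain ⟨-, m₀⟩ := hne
      generalize G.rounds = n
      induction n with
      | zero => exact ⟨_, _, rfl⟩
      | succ n ih =>
        obtain ⟨S, T, hST⟩ := ih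
        refine ⟨krausMap (G.stepA n).kraus S, krausMap
          (fun i => ((G.stepB n).kraus i).submatrix (fun b => (m₀, b)) (fun b => (m₀, b))) T, ?_⟩
        rw [evo, hST, aliceAct_eq, krausMap_kronecker, bobAct_eq]
        -- With a single basis message, operators on message and memory are operators on the memory
        -- alone.
        have : ∀ K : Matrix (M × G.memB) (M × G.memB) ℂ, (onBob K :
            Matrix ((G.memA × M) × G.memB) ((G.memA × M) × G.memB) ℂ) =
            1 ⊗ₖ K.submatrix (fun b => (m₀, b)) (fun b => (m₀, b)) := by
          intro K
          ext ⟨⟨a, m⟩, b⟩ ⟨⟨a', m'⟩, b'⟩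
          simp [onBob, one_apply, Subsingleton.elim m m₀, Subsingleton.elim m' m₀]
        simp only [this, krausMap, conjTranspose_kronecker, ← mul_kronecker_mul, conjTranspose_one,
          one_mul, mul_one, kronecker_sum]
  obtain ⟨S, T, hST⟩ := hev
  refine ⟨fun x => (G.outA.effect x * S).trace, fun y => (G.outB.effect y * T).trace,
    fun x y => ?_⟩
  rw [Game.joint, hST, ← mul_kronecker_mul, trace_kronecker]

/-- Independent outputs cannot be perfectly correlated: `p 0 * q 0` and `p 1 * q 1` would be `1 / 2`
while `p 0 * q 1 = 0`. This yields two message states to carry bits and the positive number of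
rounds needed for composition. -/
theorem IsWCF.rounds_pos_and_nontrivial (h : IsWCF P (1 / 2) ε) :
    0 < P.rounds ∧ Nontrivial P.Msg := by
  by_contra hc
  have : P.game.rounds = 0 ∨ Subsingleton P.Msg := by
    rw [← not_nontrivial_iff_subsingleton]
    by_contra hc'
    push Not at hc'
    exact hc ⟨Nat.pos_of_ne_zero hc'.1, hc'.2⟩
  obtain ⟨p, q, hpq⟩ := P.game.joint_eq_mul_of_trivial this
  have h00 := h.joint (some 0) (some 0)
  have h11 := h.joint (some 1) (some 1)
  have h01 := h.joint (some 0) (some 1)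
  simp only [hpq] at h00 h11 h01
  simp at h00 h11 h01
  rcases h01 with h | h <;> simp [h] at h00 h11

/-- The outcome of a weak coin flip as seen by the two players: `true` means that Alice wins.
An abort counts as a loss of the other player. -/
abbrev Protocol.flip (P : Protocol) : Game P.Msg Bool :=
  P.game.map (fun x => decide (x ≠ some 1)) (fun y => decide (y = some 0))

/-- Treating Bob's abort as his win costs nothing: he concedes exactly when his output is `0`, the
event bounded by the weak coin flip. -/
theorem IsWCF.flip_aliceBound (h : IsWCF P (1 / 2) ε) :
    P.flip.AliceBound (fun w => if w then 1 else 0) (1 / 2 + ε) :=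
  Game.AliceBound.map (by simpa using h.aliceBound)

theorem IsWCF.flip_bobBound (h : IsWCF P (1 / 2) ε) :
    P.flip.BobBound (fun w => if w then 0 else 1) (1 / 2 + ε) := by
  have h1 := h.bobBound
  norm_num at h1
  refine Game.BobBound.map ?_
  norm_num
  simpa using h1

theorem IsWCF.flip_joint (h : IsWCF P (1 / 2) ε) (x y : Bool) :
    P.flip.joint x y = if x = y then 1 / 2 else 0 := by
  rw [Game.joint_map]
  simp only [h.joint, Finset.sum_filter, Fintype.sum_option, Fin.sum_univ_two]
  cases x <;> cases y <;> simp

end WCF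

/-! ### Biased weak coin flips, one binary digit at a time -/

namespace Game

variable {M : Type} [Fintype M] [DecidableEq M]

/-- A coin flip that Alice wins (output `true`) with probability `z` if both players are honest,
and in which no cheating player gains more than `η`. -/
structure IsBiased (G : Game M Bool) (z η : ℝ) : Prop where
  joint_eq : ∀ x y, G.joint x y = if x = y then ((if x then z else 1 - z : ℝ) : ℂ) else 0
  alice : ∃ a, 0 ≤ a ∧ a ≤ 1 ∧ a ≤ z + η ∧ G.AliceBound (fun w => if w then 1 else 0) a
  bob : ∃ b, 0 ≤ b ∧ b ≤ 1 ∧ b ≤ 1 - z + η ∧ G.BobBound (fun w => if w then 0 else 1) b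

/-- The game without communication that Bob wins. -/
noncomputable abbrev bobWins (m₀ : M) : Game M Bool where
  rounds := 0
  memA := Unit
  memB := Unit
  initA := DensityOp.diagonal (fun z => if z.2 = m₀ then 1 else 0)
    (fun z => by split_ifs <;> norm_num) (by rw [Fintype.sum_prod_type]; simp)
  initB := DensityOp.diagonal (fun _ => 1) (fun _ => by norm_num) (by simp)
  stepA _ := Channel.id _
  stepB _ := Channel.id _
  outA := Measurement.standard fun _ => false
  outB := Measurement.standard fun _ => false

theorem isBiased_bobWins (m₀ : M) {η : ℝ} (hη : 0 ≤ η) : (bobWins m₀).IsBiased 0 η := by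
  have htrue : ∀ n : Type, ∀ [Fintype n] [DecidableEq n],
      (Measurement.standard fun _ : n => false).effect true = 0 := by
    intro n _ _
    simp [Measurement.standard]
  have hfalse : ∀ n : Type, ∀ [Fintype n] [DecidableEq n],
      (Measurement.standard fun _ : n => false).effect false = 1 := by
    intro n _ _
    simp [Measurement.standard]
  refine ⟨fun x y => ?_, ⟨0, le_rfl, by norm_num, by linarith, ?_⟩,
    ⟨1, by norm_num, le_rfl, by linarith, ?_⟩⟩
  · cases x <;> cases y <;> simp only [Game.joint, htrue, hfalse, zero_kronecker, kronecker_zero]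
    · rw [one_kronecker_one, one_mul, trace_evo, trace_kronecker, DensityOp.trace_eq_one,
        DensityOp.trace_eq_one]
      simp
    all_goals simp
  · intro A _ _ ρ _ α
    simp [htrue]
  · exact (bobBound_const _ 1).mono (fun x => by split_ifs <;> norm_num) le_rfl

/-- A balanced coin flip together with its cheating bounds. -/
structure IsBalanced (F : Game M Bool) (h : ℝ) : Prop where
  joint_eq : ∀ x y, F.joint x y = if x = y then 1 / 2 else 0
  alice : F.AliceBound (fun w => if w then 1 else 0) h
  bob : F.BobBound (fun w => if w then 0 else 1) h

variable {G F : Game M Bool} {z ε h : ℝ}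

/-- Alice gets `a + (1 - a) * h` and Bob `b * h`. Since `h ≤ 1 / 2 + ε` and `a`, `b` lie in `[0,
1]`, the old gain `2 * ε` is halved and at most `ε` is added, so `2 * ε` is reproduced. -/
theorem IsBiased.or (hG : G.IsBiased z (2 * ε)) (hF : F.IsBalanced h) (hr : 0 < F.rounds)
    (h₀ : 0 ≤ h) (h₁ : h ≤ 1) (hε : 0 ≤ ε) (hh : h ≤ 1 / 2 + ε) :
    ((G.seq F).map (fun x => x.1 || x.2) (fun x => x.1 || x.2)).IsBiased ((1 + z) / 2)
      (2 * ε) := by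
  obtain ⟨a, ha0, ha1, ha2, ha⟩ := hG.alice
  obtain ⟨b, hb0, hb1, hb2, hb⟩ := hG.bob
  refine ⟨fun x y => ?_, ⟨(1 - h) * a + h, by nlinarith, by nlinarith, by nlinarith, ?_⟩,
    ⟨h * b + 0, by nlinarith, by nlinarith, by nlinarith, ?_⟩⟩
  · rw [joint_map]
    simp only [Finset.sum_filter, Fintype.sum_prod_type, Fintype.sum_bool, joint_seq _ _ hr,
      hG.joint_eq, hF.joint_eq]
    cases x <;> cases y <;> simp <;> ring
  -- Before the balanced flip, Alice's prospect is `1` if she has won `G` and `h` if not: an affine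
  -- function of winning `G`.
  · refine AliceBound.map (AliceBound.seq (ha.affine (1 - h) h (by linarith)) fun w => ?_)
    cases w
    · simpa using hF.alice
    · simpa using aliceBound_const F 1
  · refine BobBound.map (BobBound.seq hr (hb.affine h 0 h₀) fun w => ?_)
    cases w
    · simpa using hF.bob
    · simpa using bobBound_const F 0

/-- The estimate of `IsBiased.or` with the two players exchanged. -/
theorem IsBiased.and (hG : G.IsBiased z (2 * ε)) (hF : F.IsBalanced h) (hr : 0 < F.rounds)
    (h₀ : 0 ≤ h) (h₁ : h ≤ 1) (hε : 0 ≤ ε) (hh : h ≤ 1 / 2 + ε) :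
    ((G.seq F).map (fun x => x.1 && x.2) (fun x => x.1 && x.2)).IsBiased (z / 2) (2 * ε) := by
  obtain ⟨a, ha0, ha1, ha2, ha⟩ := hG.alice
  obtain ⟨b, hb0, hb1, hb2, hb⟩ := hG.bob
  refine ⟨fun x y => ?_, ⟨h * a + 0, by nlinarith, by nlinarith, by nlinarith, ?_⟩,
    ⟨(1 - h) * b + h, by nlinarith, by nlinarith, by nlinarith, ?_⟩⟩
  · rw [joint_map]
    simp only [Finset.sum_filter, Fintype.sum_prod_type, Fintype.sum_bool, joint_seq _ _ hr,
      hG.joint_eq, hF.joint_eq]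
    cases x <;> cases y <;> simp <;> ring
  · refine AliceBound.map (AliceBound.seq (ha.affine h 0 h₀) fun w => ?_)
    cases w
    · simpa using aliceBound_const F 0
    · simpa using hF.alice
  · refine BobBound.map (BobBound.seq hr (hb.affine (1 - h) h (by linarith)) fun w => ?_)
    cases w
    · simpa using bobBound_const F 1
    · simpa using hF.bob

/-- Biased coin flips by repetition of balanced ones, one for each binary digit of the bias. -/
theorem IsBalanced.exists_isBiased (hF : F.IsBalanced h) (hr : 0 < F.rounds) (m₀ : M)
    (h₀ : 0 ≤ h) (h₁ : h ≤ 1) (hε : 0 ≤ ε) (hh : h ≤ 1 / 2 + ε) (n : ℕ) :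
    ∀ t : ℝ, 0 ≤ t → t ≤ 1 → ∃ (G : Game M Bool) (z : ℝ), G.rounds = n * F.rounds ∧
      |z - t| ≤ (1 / 2) ^ n ∧ G.IsBiased z (2 * ε) := by
  induction n with
  | zero =>
    intro t ht0 ht1
    refine ⟨bobWins m₀, 0, by simp, ?_, isBiased_bobWins m₀ (by linarith)⟩
    rw [zero_sub, abs_neg, abs_of_nonneg ht0]
    simpa using ht1
  | succ n ih =>
    intro t ht0 ht1
    -- The leading binary digit of `t` selects the connective and `G` realizes the remaining digits;
    -- both connectives halve the error.
    rcases le_total (1 / 2) t with ht | ht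
    · obtain ⟨G, z, hrounds, hz, hG⟩ := ih (2 * t - 1) (by linarith) (by linarith)
      refine ⟨_, _, ?_, ?_, hG.or hF hr h₀ h₁ hε hh⟩
      · simp only [hrounds]
        ring
      · rw [show (1 + z) / 2 - t = (z - (2 * t - 1)) * (1 / 2) by ring, abs_mul, pow_succ,
          abs_of_pos (one_half_pos (α := ℝ))]
        linarith
    · obtain ⟨G, z, hrounds, hz, hG⟩ := ih (2 * t) (by linarith) (by linarith)
      refine ⟨_, _, ?_, ?_, hG.and hF hr h₀ h₁ hε hh⟩
      · simp only [hrounds]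
        ring
      · rw [show z / 2 - t = (z - 2 * t) * (1 / 2) by ring, abs_mul, pow_succ,
          abs_of_pos (one_half_pos (α := ℝ))]
        linarith

/-- The protocol in which the honest players play a given game. -/
abbrev toProtocol (G : Game M Outcome) : Protocol where
  rounds := G.rounds
  Msg := M
  alice := { mem := G.memA, init := G.initA, step := G.stepA, output := G.outA }
  bob := { mem := G.memB, init := G.initB, step := G.stepB, output := G.outB }

/-- The outcome is `v` only if both players output `v`; ignoring the cheater's output can only
increase the probability. -/
theorem AliceBound.prob_le {G : Game M Outcome} {v : Fin 2} {δ : ℝ}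
    (hG : G.AliceBound (fun y => if y = some v then 1 else 0) δ) (a : AliceStrategy M) :
    G.toProtocol.prob a G.toProtocol.bob (some v) ≤ δ := by
  have h := hG a.mem a.init.mat a.init.posSemidef a.step
  rw [Fintype.sum_eq_single (some v) (fun y hy => by simp [hy]), a.init.trace_eq_one] at h
  simp only [if_true, one_mul, Complex.one_re, mul_one] at h
  rw [Protocol.prob, outcomeProb_some, jointProb, state_eq_evo]
  refine le_trans ?_ h
  rw [← a.output.sum_eq_one, sum_kronecker, Finset.sum_mul, trace_sum, Complex.re_sum]
  exact Finset.single_le_sum (f := fun x => ((a.output.effect x ⊗ₖ G.outB.effect (some v)) *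
    evo a.step G.stepB (a.init.mat ⊗ₖ G.initB.mat) G.rounds).trace.re)
    (fun x _ => (Complex.nonneg_iff.mp (trace_mul_nonneg
      ((a.output.posSemidef x).kronecker (G.outB.posSemidef _))
      (evo_posSemidef _ _ (a.init.posSemidef.kronecker G.initB.posSemidef) _))).1)
    (Finset.mem_univ _)

theorem BobBound.prob_le {G : Game M Outcome} {v : Fin 2} {δ : ℝ}
    (hG : G.BobBound (fun y => if y = some v then 1 else 0) δ) (b : BobStrategy M) :
    G.toProtocol.prob G.toProtocol.alice b (some v) ≤ δ := by
  have h := hG b.mem b.init.mat b.init.posSemidef b.step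
  rw [Fintype.sum_eq_single (some v) (fun y hy => by simp [hy]), b.init.trace_eq_one] at h
  simp only [if_true, one_mul, Complex.one_re, mul_one] at h
  rw [Protocol.prob, outcomeProb_some, jointProb, state_eq_evo]
  refine le_trans ?_ h
  rw [← b.output.sum_eq_one, kronecker_sum, Finset.sum_mul, trace_sum, Complex.re_sum]
  exact Finset.single_le_sum (f := fun y => ((G.outA.effect (some v) ⊗ₖ b.output.effect y) *
    evo G.stepA b.step (G.initA.mat ⊗ₖ b.init.mat) G.rounds).trace.re)
    (fun y _ => (Complex.nonneg_iff.mp (trace_mul_nonneg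
      ((G.outA.posSemidef _).kronecker (b.output.posSemidef y))
      (evo_posSemidef _ _ (G.initA.posSemidef.kronecker b.init.posSemidef) _))).1)
    (Finset.mem_univ _)

/-! ### The strong coin flip -/

/-- The outcome of the strong coin flip: Alice's bit if she wins the weak coin flip, and her bit
plus Bob's otherwise. -/
def strongOutcome (x : Bool × (Bool × Bool)) : Outcome :=
  some (if (if x.2.1 then x.1 else xor x.1 x.2.2) then 1 else 0)

/-- Alice tells Bob a random bit, a biased weak coin is flipped, and Bob tells Alice a random bit
by which he changes the outcome if he has won. -/
noncomputable abbrev strong (m₀ m₁ : M) (s : ℝ) (h₀ : 0 ≤ s) (h₁ : s ≤ 1) (W : Game M Bool) :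
    Game M Outcome :=
  ((aliceBit m₀ m₁).seq (W.seq (bobBit m₀ m₁ s h₀ h₁))).map strongOutcome strongOutcome

variable {m₀ m₁ : M} {s η δ : ℝ} {W : Game M Bool}

theorem joint_strong (hm : m₀ ≠ m₁) (h₀ : 0 ≤ s) (h₁ : s ≤ 1) (hW : W.IsBiased z η) (v : Fin 2) :
    (strong m₀ m₁ s h₀ h₁ W).joint (some v) (some v) = 1 / 2 := by
  rw [joint_map]
  simp only [Finset.sum_filter, Fintype.sum_prod_type, Fintype.sum_bool]
  simp only [joint_seq _ (W.seq (bobBit m₀ m₁ s h₀ h₁)) (Nat.succ_pos _),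
    joint_seq W (bobBit m₀ m₁ s h₀ h₁) Nat.one_pos, joint_aliceBit hm, joint_bobBit hm,
    hW.joint_eq, strongOutcome]
  fin_cases v <;> simp <;> ring

/-- If Alice's bit is already `v`, winning the weak flip is worth `1` and losing it `1 - s`.
Otherwise winning is worth `0` and losing `s`, so the constant bound `s` suffices. -/
theorem aliceBound_strong (h₀ : 0 ≤ s) (h₁ : s ≤ 1) {a : ℝ}
    (hW : W.AliceBound (fun w => if w then 1 else 0) a) (hδ : s ≤ δ) (hδ' : s * a + (1 - s) ≤ δ)
    (v : Fin 2) :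
    (strong m₀ m₁ s h₀ h₁ W).AliceBound (fun y => if y = some v then 1 else 0) δ := by
  refine AliceBound.map (AliceBound.seq (aliceBound_const _ δ) fun c => ?_)
  by_cases hc : v = if c then 1 else 0
  · refine (AliceBound.seq (hW.affine s (1 - s) h₀) fun w => ?_).mono (fun _ => le_rfl) hδ'
    refine (aliceBound_bobBit m₀ m₁ s h₀ h₁ _).mono (fun _ => le_rfl) ?_
    subst hc
    cases c <;> cases w <;> simp [strongOutcome]
  · refine (AliceBound.seq (aliceBound_const W s) fun w => ?_).mono (fun _ => le_rfl) hδ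
    refine (aliceBound_bobBit m₀ m₁ s h₀ h₁ _).mono (fun _ => le_rfl) ?_
    revert hc
    fin_cases v <;> cases c <;> cases w <;> simp [strongOutcome, h₀]

/-- Bob cannot influence Alice's bit. If it is `v`, his chance is bounded by `1`; if not, he must
win the weak flip to be able to change it, with chance `b`. -/
theorem bobBound_strong (h₀ : 0 ≤ s) (h₁ : s ≤ 1) {b : ℝ}
    (hW : W.BobBound (fun w => if w then 0 else 1) b) (hδ : (1 + b) / 2 ≤ δ) (v : Fin 2) :
    (strong m₀ m₁ s h₀ h₁ W).BobBound (fun y => if y = some v then 1 else 0) δ := by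
  refine BobBound.map ((BobBound.seq (Nat.succ_pos _) (bobBound_aliceBit m₀ m₁
    (fun c => if v = (if c then 1 else 0) then 1 else b)) fun c => ?_).mono (fun _ => le_rfl) ?_)
  · by_cases hc : v = if c then 1 else 0
    · rw [if_pos hc]
      exact (bobBound_const _ 1).mono (fun _ => by split_ifs <;> norm_num) le_rfl
    · rw [if_neg hc]
      refine BobBound.seq Nat.one_pos hW fun w => ?_
      refine (bobBound_const _ _).mono (fun d => ?_) le_rfl
      revert hc
      fin_cases v <;> cases c <;> cases w <;> cases d <;> simp [strongOutcome]
  · refine le_trans (le_of_eq ?_) hδ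
    fin_cases v <;> simp [add_comm]

end Game

/-! ### Choice of parameters -/

/-- The cap at `1` keeps the weight `1 - h` in the recursion nonnegative when `ε` is large. -/
theorem IsWCF.flip_isBalanced {P : Protocol} {ε : ℝ} (h : IsWCF P (1 / 2) ε) :
    P.flip.IsBalanced (min 1 (1 / 2 + ε)) := by
  refine ⟨h.flip_joint, ?_, ?_⟩
  · rcases min_choice (1 : ℝ) (1 / 2 + ε) with h' | h' <;> rw [h']
    · exact (Game.aliceBound_const _ 1).mono (fun _ => by split_ifs <;> norm_num) le_rfl
    · exact h.flip_aliceBound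
  · rcases min_choice (1 : ℝ) (1 / 2 + ε) with h' | h' <;> rw [h']
    · exact (Game.bobBound_const _ 1).mono (fun _ => by split_ifs <;> norm_num) le_rfl
    · exact h.flip_bobBound

/-- The factor `2` in the number of digits makes the error `ε ^ 2`, which is `o(ε)`, instead of `ε`.
For `ε > 1` the natural-number ceiling is `0`, and the bound reads `1 ≤ ε ^ 2`. -/
theorem half_pow_two_mul_ceil_logb_le {ε : ℝ} (hε : 0 < ε) :
    (1 / 2 : ℝ) ^ (2 * ⌈Real.logb 2 (1 / ε)⌉₊) ≤ ε ^ 2 := by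
  have h := Nat.le_ceil (Real.logb 2 (1 / ε))
  rw [Real.logb_le_iff_le_rpow one_lt_two (by positivity), Real.rpow_natCast] at h
  rw [mul_comm, pow_mul]
  refine pow_le_pow_left₀ (by positivity) ?_ 2
  rw [one_div, inv_pow]
  exact inv_le_of_inv_le₀ hε (by simpa using h)

/-- Strong coin flipping from balanced weak coin flipping. -/
theorem IsWCF.exists_isSCF {P : Protocol} {ε : ℝ} (hε : 0 < ε) (h : IsWCF P (1 / 2) ε) :
    ∃ S : Protocol, S.rounds = 2 * ⌈Real.logb 2 (1 / ε)⌉₊ * P.rounds + 2 ∧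
      IsSCF S (1 / Real.sqrt 2 + Real.sqrt 2 * ε + ε ^ 2) := by
  obtain ⟨hr, m₀, m₁, hm⟩ := h.rounds_pos_and_nontrivial
  set q := Real.sqrt 2 with hq
  have hq2 : q * q = 2 := Real.mul_self_sqrt (by norm_num)
  have hq1 : 1 ≤ q := Real.one_le_sqrt.mpr (by norm_num)
  have hq3 : q ≤ 2 := by nlinarith
  have hs : 1 / q = q / 2 := by
    rw [div_eq_div_iff (by positivity) (by norm_num)]
    linarith
  -- The target `2 - q`, together with `s = q / 2`, equalizes the cheating probabilities `s`, `1 - s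
  -- * (1 - z)` and `1 - z / 2`.
  obtain ⟨W, z, hrounds, hz, hW⟩ := h.flip_isBalanced.exists_isBiased hr m₀
    (le_min zero_le_one (by linarith)) (min_le_left _ _) hε.le (min_le_right _ _)
    (2 * ⌈Real.logb 2 (1 / ε)⌉₊) (2 - q) (by linarith) (by linarith)
  obtain ⟨hz1, hz2⟩ := abs_le.mp (hz.trans (half_pow_two_mul_ceil_logb_le hε))
  have h₀ : 0 ≤ q / 2 := by linarith
  have h₁ : q / 2 ≤ 1 := by linarith
  rw [hs]
  obtain ⟨a, ha0, ha1, ha2, ha⟩ := hW.alice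
  obtain ⟨b, hb0, hb1, hb2, hb⟩ := hW.bob
  -- Bob's gain of `2 * ε` enters with weight `1 / 2` and contributes only `ε`; the term `q * ε` is
  -- Alice's.
  have hqε : ε ≤ q * ε := by nlinarith
  refine ⟨(Game.strong m₀ m₁ (q / 2) h₀ h₁ W).toProtocol, ?_, fun v => ?_, fun b v => ?_,
    fun a v => ?_⟩
  -- The two additional rounds carry Alice's bit and Bob's bit.
  · change 1 + (W.rounds + 1) = _
    rw [hrounds]
    ring
  · rw [Protocol.prob_honest]
    have := Game.joint_strong hm h₀ h₁ hW v
    exact (congrArg Complex.re this).trans (by norm_num)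
  · refine Game.AliceBound.prob_le (Game.aliceBound_strong h₀ h₁ ha ?_ ?_ v) b
    · nlinarith
    -- As `q * q = 2`, the right side is `q - 1 + q * ε + q / 2 * ε ^ 2`; adding `1 - q / 2` gives
    -- `q / 2 + q * ε` up to at most `ε ^ 2`.
    · have : q / 2 * a ≤ q / 2 * (2 - q + ε ^ 2 + 2 * ε) :=
        mul_le_mul_of_nonneg_left (by linarith) h₀
      nlinarith [sq_nonneg ε]
  · refine Game.BobBound.prob_le (Game.bobBound_strong h₀ h₁ hb ?_ v) a
    nlinarith [sq_nonneg ε]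

end CoinFlip

theorem theorem1 :
    ∃ r : ℝ → ℝ, r =o[nhdsWithin 0 (Set.Ioi 0)] (fun ε : ℝ => ε) ∧
      ∀ (ε : ℝ) (N : ℕ), 0 < ε →
        (∃ P : CoinFlip.Protocol, P.rounds = N ∧ CoinFlip.IsWCF P (1 / 2) ε) →
        ∃ S : CoinFlip.Protocol,
          S.rounds = 2 * ⌈Real.logb 2 (1 / ε)⌉₊ * N + 2 ∧
          CoinFlip.IsSCF S (1 / Real.sqrt 2 + Real.sqrt 2 * ε + r ε) := by
  refine ⟨fun ε => ε ^ 2, ?_, ?_⟩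
  · exact (Asymptotics.isLittleO_pow_id one_lt_two).mono nhdsWithin_le_nhds
  · rintro ε _ hε ⟨P, rfl, hP⟩
    exact hP.exists_isSCF hε
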